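/- Let $n\ge 1$. A cube in $\mathbb{R}^n$ is a half-open set $Q=[a_1,a_1+l)\times\dots\times[a_n,a_n+l)$ with $l=l(Q)>0$, and $|\cdot|$ is Lebesgue measure. For a cube $Q_0$ let $\mathcal{D}(Q_0)=\bigcup_{j\ge 0}\mathcal{D}^j(Q_0)$, where $\mathcal{D}^j(Q_0)$ is the partition of $Q_0$ into $2^{jn}$ cubes of side length $2^{-j}l(Q_0)$; for $Q\in\mathcal{D}^{j}(Q_0)$ with $j\ge 1$ let $\pi Q$ be the unique cube of $\mathcal{D}^{j-1}(Q_0)$ that contains $Q$. For a set $E\subset\mathbb{R}^n$ and a cube $Q_0$ meeting $\overline{E}$ put $$\mathcal{D}_E(Q_0)=\{Q\in\mathcal{D}(Q_0): Q\cap\overline{E}=\emptyset,\ \pi Q\cap\overline{E}\ne\emptyset\}.$$ For $1<p<\infty$, $A_p$ is the class of locally integrable functions $w$ on $\mathbb{R}^n$ that are positive almost everywhere and for which there is $C>0$ with $$\Big(\frac1{|Q|}\int_Q w\,dx\Big)\Big(\frac1{|Q|}\int_Q w^{-\frac1{p-1}}\,dx\Big)^{p-1}\le C\quad\text{for every cube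 }Q\subset\mathbb{R}^n.$$ **Theorem.** Let $E\subset\mathbb{R}^n$ be a non-empty set. Then the following statements are equivalent. (I) There exist $C_0>0$ and $0<s<(1+2^n)^{-1}$ such that $$0<\frac{\sup\big\{L\ge 0:\ \sum_{Q\in\mathcal{D}_E(Q_0),\ l(Q)\ge L}|Q|\ge s|Q_0|\big\}}{\inf\big\{L\ge 0:\ \sum_{Q\in\mathcal{D}_E(Q_0),\ l(Q)\le L}|Q|\ge s|Q_0|\big\}}\le C_0$$ for every cube $Q_0\subset\mathbb{R}^n$ that meets $\overline{E}$ (with the conventions $\sup\emptyset=0$, $\inf\emptyset=\infty$ and $a/\infty=0$ for $0\le a<\infty$). (II) For every $p\in(1,\infty)$ there exists $\theta\in\mathbb{R}$, $\theta\ne 0$, such that $\operatorname{dist}(\cdot,E)^\theta\in A_p$, where $\operatorname{dist}(x,E)=\inf_{e\in E}|x-e|$. -/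

import Mathlib

open MeasureTheory
open scoped ENNReal

noncomputable section

/-- A half-open cube `[a₁, a₁ + l) × ⋯ × [aₙ, aₙ + l)` in `ℝⁿ` with sides parallel to the axes,
recorded by its lower corner `a` and its side length `l > 0`. -/
structure HalfOpenCube (n : ℕ) where
  corner : EuclideanSpace ℝ (Fin n)
  side : ℝ
  side_pos : 0 < side

/-- The points of a half-open cube. -/
def HalfOpenCube.toSet {n : ℕ} (Q : HalfOpenCube n) : Set (EuclideanSpace ℝ (Fin n)) :=
  {x | ∀ i, Q.corner i ≤ x i ∧ x i < Q.corner i + Q.side}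

/-- The dyadic subcubes of `Q₀` of generation `j`: the `2 ^ (j n)` pairwise disjoint cubes of side
`2⁻ʲ l(Q₀)` into which `Q₀` splits. -/
def HalfOpenCube.dyadicGen {n : ℕ} (Q₀ : HalfOpenCube n) (j : ℕ) : Set (HalfOpenCube n) :=
  {Q | Q.side = Q₀.side / 2 ^ j ∧
    ∃ k : Fin n → ℕ, ∀ i, k i < 2 ^ j ∧
      Q.corner i = Q₀.corner i + (k i : ℝ) * (Q₀.side / 2 ^ j)}

/-- The dyadic system of `Q₀`. -/
def HalfOpenCube.dyadic {n : ℕ} (Q₀ : HalfOpenCube n) : Set (HalfOpenCube n) :=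
  {Q | ∃ j : ℕ, Q ∈ Q₀.dyadicGen j}

/-- `P` is the dyadic father of `Q` in the dyadic system of `Q₀`: the cube of the preceding
generation that contains `Q` (the cube `Q₀` itself has no father). -/
def HalfOpenCube.IsFather {n : ℕ} (Q₀ P Q : HalfOpenCube n) : Prop :=
  ∃ j : ℕ, Q ∈ Q₀.dyadicGen (j + 1) ∧ P ∈ Q₀.dyadicGen j ∧ Q.toSet ⊆ P.toSet

/-- The dyadic pores of `E` in `Q₀`: the dyadic subcubes of `Q₀` that miss the closure of `E` and
whose dyadic father meets it. -/
def dyadicPores {n : ℕ} (E : Set (EuclideanSpace ℝ (Fin n))) (Q₀ : HalfOpenCube n) :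
    Set (HalfOpenCube n) :=
  {Q | Q ∈ Q₀.dyadic ∧ Q.toSet ∩ closure E = ∅ ∧
    ∃ P, HalfOpenCube.IsFather Q₀ P Q ∧ (P.toSet ∩ closure E).Nonempty}

/-- The `L ≥ 0` such that the pores of side at least `L` have total measure at least
`s |Q₀|`. -/
def largePoreSet {n : ℕ} (s : ℝ) (Q₀ : HalfOpenCube n) (E : Set (EuclideanSpace ℝ (Fin n))) :
    Set ℝ :=
  {L | 0 ≤ L ∧ ENNReal.ofReal s * volume Q₀.toSet ≤
    ∑' Q : {Q : HalfOpenCube n // Q ∈ dyadicPores E Q₀ ∧ L ≤ Q.side}, volume Q.1.toSet}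

/-- The `L ≥ 0` such that the pores of side at most `L` have total measure at least
`s |Q₀|`. -/
def smallPoreSet {n : ℕ} (s : ℝ) (Q₀ : HalfOpenCube n) (E : Set (EuclideanSpace ℝ (Fin n))) :
    Set ℝ :=
  {L | 0 ≤ L ∧ ENNReal.ofReal s * volume Q₀.toSet ≤
    ∑' Q : {Q : HalfOpenCube n // Q ∈ dyadicPores E Q₀ ∧ Q.side ≤ L}, volume Q.1.toSet}

/-- The quotient of the supremum of `largePoreSet` by the infimum of `smallPoreSet`, taken in
`[0, ∞]`, so that the supremum of the empty set is `0` and its infimum is `∞`. -/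
def poreRatio {n : ℕ} (s : ℝ) (Q₀ : HalfOpenCube n) (E : Set (EuclideanSpace ℝ (Fin n))) : ℝ≥0∞ :=
  (⨆ L ∈ largePoreSet s Q₀ E, ENNReal.ofReal L) / (⨅ L ∈ smallPoreSet s Q₀ E, ENNReal.ofReal L)

/-- A weight in `ℝⁿ`: a locally integrable function that is positive almost everywhere. -/
def IsWeight {n : ℕ} (w : EuclideanSpace ℝ (Fin n) → ℝ) : Prop :=
  LocallyIntegrable w volume ∧ ∀ᵐ x ∂(volume : Measure (EuclideanSpace ℝ (Fin n))), 0 < w x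

/-- The Muckenhoupt class `A_p` for `1 < p < ∞`. The means are taken in `[0, ∞]`; the first one
is positive for a weight, so the bound forces the second one to be finite. -/
def MemMuckenhoupt {n : ℕ} (p : ℝ) (w : EuclideanSpace ℝ (Fin n) → ℝ) : Prop :=
  IsWeight w ∧ ∃ C : ℝ, 0 < C ∧ ∀ Q : HalfOpenCube n,
    (⨍⁻ x in Q.toSet, ENNReal.ofReal (w x) ∂volume) *
      (⨍⁻ x in Q.toSet, ENNReal.ofReal (w x ^ (-(1 / (p - 1)))) ∂volume) ^ (p - 1)
      ≤ ENNReal.ofReal C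

end

noncomputable section

/-! ### Dyadic cells, addressed by generation and by point -/

namespace HalfOpenCube

variable {n : ℕ}

/-! Let f be the logarithm of the side of the pore that contains a given point. Condition (I) says
that f has bounded local oscillation: on every cube meeting `closure E`, f lies in an interval of
length at most log(4C₀), outside two exceptional sets of relative measure at most s each
(`exists_median_bounds`). The rest of (I) ⇒ (II) is a John–Nirenberg argument.

Let A be the set where f exceeds the upper bound b(Q), and stop at the maximal dyadic cubes P in
which A has density greater than σ. The father of P is not selected, so A has density at most 2ⁿσ in
P. If 2ⁿσ + s < 1, the lower bound of f on P cannot exceed b(Q), so the upper bound rises by at most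
K from Q to P. The selected cubes have total measure at most (s/σ)|Q|. Iteration gives geometric
decay with ratio s/σ (`volume_superlevel_le`). A σ with s < σ and 2ⁿσ + s < 1 exists exactly when s
< (1+2ⁿ)⁻¹.

The decay, applied to f and to -f, bounds the means of small positive and negative powers of the
pore side. To pass to the distance: it is at most a multiple of the pore side pointwise, and its
small negative powers have the expected mean over each pore, since thin boundary shells have small
volume. Cubes away from E are treated directly.

Conversely, take p = 2. Pores of side at least L bound the mean of dist^τ below by a multiple of
L^τ, and pores of side at most L' bound the mean of dist^(-τ) below by a multiple of L'^(-τ). The A₂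
inequality then bounds L/L' (`exists_poreRatio_le`).

In both directions `closure E` is null, so pores fill almost all of each cube meeting it. -/

theorem eq_of_corner_of_side {P Q : HalfOpenCube n} (h : ∀ i, P.corner i = Q.corner i)
    (h' : P.side = Q.side) : P = Q := by
  cases P; cases Q
  simp only [mk.injEq] at *
  exact ⟨PiLp.ext h, h'⟩

/-- The cell with integer coordinates `k` in the grid of mesh `2⁻ʲ l(Q)` anchored at the corner
of `Q`. -/
def cell (Q : HalfOpenCube n) (j : ℕ) (k : Fin n → ℕ) : HalfOpenCube n where
  corner := WithLp.toLp 2 fun i => Q.corner i + (k i : ℝ) * (Q.side / 2 ^ j)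
  side := Q.side / 2 ^ j
  side_pos := div_pos Q.side_pos (by positivity)

/-- The integer coordinates of the cell of generation `j` that contains `x`. -/
def index (Q : HalfOpenCube n) (j : ℕ) (x : EuclideanSpace ℝ (Fin n)) : Fin n → ℕ :=
  fun i => ⌊(x i - Q.corner i) / (Q.side / 2 ^ j)⌋₊

/-- The dyadic subcube of `Q` of generation `j` that contains `x`. -/
def cellAt (Q : HalfOpenCube n) (j : ℕ) (x : EuclideanSpace ℝ (Fin n)) : HalfOpenCube n :=
  Q.cell j (Q.index j x)

theorem cell_side_pos (Q : HalfOpenCube n) (j : ℕ) : 0 < Q.side / 2 ^ j :=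
  div_pos Q.side_pos (by positivity)

@[simp] theorem cellAt_side (Q : HalfOpenCube n) (j : ℕ) (x : EuclideanSpace ℝ (Fin n)) :
    (Q.cellAt j x).side = Q.side / 2 ^ j := rfl

theorem mem_dyadicGen_iff {Q Q' : HalfOpenCube n} {j : ℕ} :
    Q' ∈ Q.dyadicGen j ↔ ∃ k : Fin n → ℕ, (∀ i, k i < 2 ^ j) ∧ Q' = Q.cell j k := by
  constructor
  · rintro ⟨h, k, hk⟩
    exact ⟨k, fun i => (hk i).1, eq_of_corner_of_side (fun i => (hk i).2) h⟩
  · rintro ⟨k, hk, rfl⟩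
    exact ⟨rfl, k, fun i => ⟨hk i, rfl⟩⟩

theorem mem_cell_iff {Q : HalfOpenCube n} {j : ℕ} {k : Fin n → ℕ}
    {x : EuclideanSpace ℝ (Fin n)} (hx : x ∈ Q.toSet) :
    x ∈ (Q.cell j k).toSet ↔ Q.index j x = k := by
  have hs := Q.cell_side_pos j
  simp only [toSet, cell, index, Set.mem_ofPred_eq, funext_iff]
  refine forall_congr' fun i => ?_
  rw [Nat.floor_eq_iff (div_nonneg (sub_nonneg.2 (hx i).1) hs.le), le_div_iff₀ hs, div_lt_iff₀ hs]
  constructor <;> rintro ⟨h1, h2⟩ <;> constructor <;> linarith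

theorem mem_cellAt {Q : HalfOpenCube n} {j : ℕ} {x : EuclideanSpace ℝ (Fin n)}
    (hx : x ∈ Q.toSet) : x ∈ (Q.cellAt j x).toSet :=
  (mem_cell_iff hx).2 rfl

theorem cell_subset {Q : HalfOpenCube n} {j : ℕ} {k : Fin n → ℕ} (hk : ∀ i, k i < 2 ^ j) :
    (Q.cell j k).toSet ⊆ Q.toSet := by
  intro x hx i
  have hs := Q.cell_side_pos j
  obtain ⟨h1, h2⟩ := hx i
  simp only [cell] at h1 h2
  have h3 : (k i : ℝ) + 1 ≤ 2 ^ j := by exact_mod_cast hk i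
  have h4 : (2 : ℝ) ^ j * (Q.side / 2 ^ j) = Q.side := by field_simp
  constructor
  · nlinarith [(Nat.cast_nonneg (k i) : (0 : ℝ) ≤ k i)]
  · nlinarith

theorem index_lt {Q : HalfOpenCube n} {x : EuclideanSpace ℝ (Fin n)} (hx : x ∈ Q.toSet) (j : ℕ)
    (i : Fin n) : Q.index j x i < 2 ^ j := by
  have hs := Q.cell_side_pos j
  have h4 : (2 : ℝ) ^ j * (Q.side / 2 ^ j) = Q.side := by field_simp
  rw [index, Nat.floor_lt (div_nonneg (sub_nonneg.2 (hx i).1) hs.le), div_lt_iff₀ hs]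
  push_cast
  linarith [(hx i).2]

theorem cellAt_subset {Q : HalfOpenCube n} {x : EuclideanSpace ℝ (Fin n)} (hx : x ∈ Q.toSet)
    (j : ℕ) : (Q.cellAt j x).toSet ⊆ Q.toSet :=
  cell_subset (index_lt hx j)

theorem cellAt_mem_dyadicGen {Q : HalfOpenCube n} {x : EuclideanSpace ℝ (Fin n)}
    (hx : x ∈ Q.toSet) (j : ℕ) : Q.cellAt j x ∈ Q.dyadicGen j :=
  mem_dyadicGen_iff.2 ⟨_, index_lt hx j, rfl⟩

theorem cellAt_mem_dyadic {Q : HalfOpenCube n} {x : EuclideanSpace ℝ (Fin n)}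
    (hx : x ∈ Q.toSet) (j : ℕ) : Q.cellAt j x ∈ Q.dyadic :=
  ⟨j, cellAt_mem_dyadicGen hx j⟩

theorem subset_of_mem_dyadicGen {Q Q' : HalfOpenCube n} {j : ℕ} (h : Q' ∈ Q.dyadicGen j) :
    Q'.toSet ⊆ Q.toSet := by
  obtain ⟨k, hk, rfl⟩ := mem_dyadicGen_iff.1 h
  exact cell_subset hk

theorem eq_cellAt {Q Q' : HalfOpenCube n} {j : ℕ} (h : Q' ∈ Q.dyadicGen j)
    {x : EuclideanSpace ℝ (Fin n)} (hx : x ∈ Q'.toSet) : Q' = Q.cellAt j x := by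
  have hxQ := subset_of_mem_dyadicGen h hx
  obtain ⟨k, hk, rfl⟩ := mem_dyadicGen_iff.1 h
  rw [cellAt, (mem_cell_iff hxQ).1 hx]

theorem toSet_nonempty (Q : HalfOpenCube n) : Q.toSet.Nonempty :=
  ⟨Q.corner, fun i => ⟨le_rfl, by linarith [Q.side_pos]⟩⟩

/-- Floors commute with division by a natural number, so a coarse index is determined by a finer
one; this is what makes the dyadic cells nested. -/
theorem index_add_div (Q : HalfOpenCube n) (j m : ℕ) (x : EuclideanSpace ℝ (Fin n)) (i : Fin n) :
    Q.index j x i = Q.index (j + m) x i / 2 ^ m := by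
  have := Q.side_pos
  rw [index, index, ← Nat.floor_div_natCast]
  congr 1
  push_cast
  rw [pow_add]
  field_simp

theorem cellAt_congr {Q : HalfOpenCube n} {i j : ℕ} (hij : i ≤ j)
    {x y : EuclideanSpace ℝ (Fin n)} (hx : x ∈ Q.toSet) (hy : y ∈ (Q.cellAt j x).toSet) :
    Q.cellAt i y = Q.cellAt i x := by
  obtain ⟨m, rfl⟩ := Nat.exists_eq_add_of_le hij
  have h := (mem_cell_iff (cellAt_subset hx _ hy)).1 hy
  have : Q.index i y = Q.index i x := by
    ext l
    rw [index_add_div Q i m, index_add_div Q i m x, h]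
  rw [cellAt, cellAt, this]

theorem cellAt_subset_cellAt {Q : HalfOpenCube n} {i j : ℕ} (hij : i ≤ j)
    {x : EuclideanSpace ℝ (Fin n)} (hx : x ∈ Q.toSet) :
    (Q.cellAt j x).toSet ⊆ (Q.cellAt i x).toSet := by
  intro y hy
  rw [← cellAt_congr hij hx hy]
  exact mem_cellAt (cellAt_subset hx _ hy)

theorem cell_cell (Q : HalfOpenCube n) (j m : ℕ) (k k' : Fin n → ℕ) :
    (Q.cell j k).cell m k' = Q.cell (j + m) (fun i => k i * 2 ^ m + k' i) := by
  refine eq_of_corner_of_side (fun i => ?_) ?_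
  · simp only [cell]
    push_cast
    rw [pow_add]
    field_simp
    ring
  · simp only [cell]
    rw [pow_add, div_div]

theorem cellAt_cellAt {Q : HalfOpenCube n} {x : EuclideanSpace ℝ (Fin n)} (hx : x ∈ Q.toSet)
    (j m : ℕ) : (Q.cellAt j x).cellAt m x = Q.cellAt (j + m) x := by
  have h : x ∈ ((Q.cellAt j x).cellAt m x).toSet := mem_cellAt (mem_cellAt hx)
  rw [cellAt, cellAt, cell_cell] at h ⊢
  rw [cellAt, (mem_cell_iff hx).1 h]

theorem cellAt_zero {Q : HalfOpenCube n} {x : EuclideanSpace ℝ (Fin n)} (hx : x ∈ Q.toSet) :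
    Q.cellAt 0 x = Q := by
  refine eq_of_corner_of_side (fun i => ?_) (by simp)
  have : Q.index 0 x i = 0 := by simpa using index_lt hx 0 i
  simp [cellAt, cell, this]

theorem cellAt_of_mem_dyadic {Q Q' : HalfOpenCube n} (h : Q' ∈ Q.dyadic) :
    ∃ j, ∀ x ∈ Q'.toSet, Q' = Q.cellAt j x :=
  let ⟨j, hj⟩ := h
  ⟨j, fun _ hx => eq_cellAt hj hx⟩

theorem subset_of_mem_dyadic {Q Q' : HalfOpenCube n} (h : Q' ∈ Q.dyadic) :
    Q'.toSet ⊆ Q.toSet :=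
  let ⟨_, hj⟩ := h
  subset_of_mem_dyadicGen hj

theorem self_mem_dyadic (Q : HalfOpenCube n) : Q ∈ Q.dyadic := by
  obtain ⟨x, hx⟩ := Q.toSet_nonempty
  have := cellAt_mem_dyadic hx 0
  rwa [cellAt_zero hx] at this

theorem dyadic_trans {Q Q' Q'' : HalfOpenCube n} (h : Q' ∈ Q.dyadic) (h' : Q'' ∈ Q'.dyadic) :
    Q'' ∈ Q.dyadic := by
  obtain ⟨x, hx⟩ := Q''.toSet_nonempty
  obtain ⟨j, hj⟩ := cellAt_of_mem_dyadic h
  obtain ⟨m, hm⟩ := cellAt_of_mem_dyadic h'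
  have hxQ' := subset_of_mem_dyadic h' hx
  have hxQ := subset_of_mem_dyadic h hxQ'
  rw [hm x hx, hj x hxQ', cellAt_cellAt hxQ]
  exact cellAt_mem_dyadic hxQ _

theorem countable_dyadic (Q : HalfOpenCube n) : Q.dyadic.Countable := by
  refine (Set.countable_range fun p : ℕ × (Fin n → ℕ) => Q.cell p.1 p.2).mono ?_
  rintro Q' ⟨j, hj⟩
  obtain ⟨k, -, rfl⟩ := mem_dyadicGen_iff.1 hj
  exact ⟨(j, k), rfl⟩

/-! ### Measure and diameter of cubes -/

theorem toSet_eq_preimage (Q : HalfOpenCube n) :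
    Q.toSet = (MeasurableEquiv.toLp 2 (Fin n → ℝ)).symm ⁻¹'
      Set.univ.pi fun i => Set.Ico (Q.corner i) (Q.corner i + Q.side) := by
  ext x
  simp [toSet]

theorem measurableSet_toSet (Q : HalfOpenCube n) : MeasurableSet Q.toSet := by
  rw [toSet_eq_preimage]
  exact (MeasurableEquiv.measurable _) (MeasurableSet.univ_pi fun i => measurableSet_Ico)

theorem volume_toSet (Q : HalfOpenCube n) : volume Q.toSet = ENNReal.ofReal (Q.side ^ n) := by
  rw [toSet_eq_preimage,
    (EuclideanSpace.volume_preserving_symm_measurableEquiv_toLp (Fin n)).measure_preimage_equiv,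
    volume_pi_pi]
  simp [Real.volume_Ico, ENNReal.ofReal_pow Q.side_pos.le]

theorem volume_toSet_ne_top (Q : HalfOpenCube n) : volume Q.toSet ≠ ∞ := by
  simp [volume_toSet]

theorem volume_toSet_ne_zero (Q : HalfOpenCube n) : volume Q.toSet ≠ 0 := by
  simp [volume_toSet, pow_pos Q.side_pos n]

theorem dist_le_of_abs_sub_le {x y : EuclideanSpace ℝ (Fin n)} {r : ℝ}
    (h : ∀ i, |x i - y i| ≤ r) : dist x y ≤ n * r := by
  have h1 : dist x y ≤ ∑ i, |x i - y i| := by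
    rw [EuclideanSpace.dist_eq]
    refine Real.sqrt_le_iff.2 ⟨Finset.sum_nonneg fun i _ => abs_nonneg _, ?_⟩
    simp only [Real.dist_eq]
    exact Finset.sum_sq_le_sq_sum_of_nonneg fun i _ => abs_nonneg _
  refine h1.trans ((Finset.sum_le_sum fun i _ => h i).trans ?_)
  simp

theorem dist_le_of_mem {Q : HalfOpenCube n} {x y : EuclideanSpace ℝ (Fin n)} (hx : x ∈ Q.toSet)
    (hy : y ∈ Q.toSet) : dist x y ≤ n * Q.side := by
  refine dist_le_of_abs_sub_le fun i => abs_le.2 ?_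
  constructor <;> linarith [(hx i).1, (hx i).2, (hy i).1, (hy i).2]

/-- The maximal dyadic subcubes of `Q` with the property `H`. -/
def stopping (Q : HalfOpenCube n) (H : HalfOpenCube n → Prop) : Set (HalfOpenCube n) :=
  {Q' | ∃ x ∈ Q.toSet, ∃ j, Q' = Q.cellAt j x ∧ H Q' ∧ ∀ i < j, ¬H (Q.cellAt i x)}

/-! ### Maximal subcubes are countable and disjoint -/

section Stopping

variable {Q Q' Q'' : HalfOpenCube n} {H : HalfOpenCube n → Prop}
  {x : EuclideanSpace ℝ (Fin n)}

theorem stopping_subset_dyadic : Q.stopping H ⊆ Q.dyadic := by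
  rintro _ ⟨x, hx, j, rfl, -⟩
  exact cellAt_mem_dyadic hx j

theorem exists_of_mem_stopping (h : Q' ∈ Q.stopping H) (hx : x ∈ Q'.toSet) :
    ∃ j, Q' = Q.cellAt j x ∧ H Q' ∧ ∀ i < j, ¬H (Q.cellAt i x) := by
  obtain ⟨y, hy, j, rfl, hH, hi⟩ := h
  refine ⟨j, (cellAt_congr le_rfl hy hx).symm, hH, fun i hij => ?_⟩
  rw [cellAt_congr hij.le hy hx]
  exact hi i hij

theorem eq_of_mem_stopping (h : Q' ∈ Q.stopping H) (h' : Q'' ∈ Q.stopping H)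
    (hx : x ∈ Q'.toSet) (hx' : x ∈ Q''.toSet) : Q' = Q'' := by
  obtain ⟨j, rfl, hH, hi⟩ := exists_of_mem_stopping h hx
  obtain ⟨j', rfl, hH', hi'⟩ := exists_of_mem_stopping h' hx'
  rcases lt_trichotomy j j' with h | rfl | h
  · exact absurd hH (hi' _ h)
  · rfl
  · exact absurd hH' (hi _ h)

theorem pairwiseDisjoint_stopping : (Q.stopping H).PairwiseDisjoint toSet := by
  intro Q' h Q'' h' hne
  exact Set.disjoint_left.2 fun x hx hx' => hne (eq_of_mem_stopping h h' hx hx')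

theorem countable_stopping : (Q.stopping H).Countable :=
  (countable_dyadic Q).mono stopping_subset_dyadic

theorem exists_mem_stopping (hx : x ∈ Q.toSet) (h : ∃ j, H (Q.cellAt j x)) :
    ∃ Q' ∈ Q.stopping H, x ∈ Q'.toSet := by
  classical
  exact ⟨_, ⟨x, hx, Nat.find h, rfl, Nat.find_spec h, fun i hi => Nat.find_min h hi⟩,
    mem_cellAt hx⟩

end Stopping

/-- The cube misses the closure of `E`. -/
def Misses (E : Set (EuclideanSpace ℝ (Fin n))) (Q : HalfOpenCube n) : Prop :=
  Q.toSet ∩ closure E = ∅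

theorem not_misses {E : Set (EuclideanSpace ℝ (Fin n))} {Q : HalfOpenCube n} :
    ¬Q.Misses E ↔ (Q.toSet ∩ closure E).Nonempty :=
  Set.nonempty_iff_ne_empty.symm

/-- Meeting `closure E` passes to ancestors, so a father that meets it forces all earlier cells to
meet it. The hypothesis on `Q` excludes generation 0, which has no father. -/
theorem dyadicPores_eq_stopping {E : Set (EuclideanSpace ℝ (Fin n))} {Q : HalfOpenCube n}
    (hQ : (Q.toSet ∩ closure E).Nonempty) : dyadicPores E Q = Q.stopping (Misses E) := by
  ext Q'
  constructor
  · rintro ⟨-, h, P, ⟨j, hj, hP, hsub⟩, hPE⟩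
    obtain ⟨x, hx⟩ := Q'.toSet_nonempty
    have hxQ := subset_of_mem_dyadicGen hj hx
    have hP' := eq_cellAt hP (hsub hx)
    refine ⟨x, hxQ, j + 1, eq_cellAt hj hx, h, fun i hi => not_misses.2 ?_⟩
    rw [hP'] at hPE
    exact hPE.mono (Set.inter_subset_inter_left _ (cellAt_subset_cellAt (by omega) hxQ))
  · rintro ⟨x, hx, j, rfl, h, hi⟩
    refine ⟨cellAt_mem_dyadic hx j, h, ?_⟩
    rcases j with _ | j
    · rw [cellAt_zero hx] at h
      exact absurd h (not_misses.2 hQ)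
    · exact ⟨Q.cellAt j x, ⟨j, cellAt_mem_dyadicGen hx _, cellAt_mem_dyadicGen hx _,
        cellAt_subset_cellAt (Nat.le_succ j) hx⟩, not_misses.1 (hi j (Nat.lt_succ_self j))⟩

theorem exists_cellAt_misses {E : Set (EuclideanSpace ℝ (Fin n))} {Q : HalfOpenCube n}
    {x : EuclideanSpace ℝ (Fin n)} (hx : x ∈ Q.toSet) (hxE : x ∉ closure E) :
    ∃ j, (Q.cellAt j x).Misses E := by
  obtain ⟨ε, hε, hball⟩ := Metric.isOpen_iff.1 isClosed_closure.isOpen_compl x hxE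
  obtain ⟨j, hj⟩ := exists_pow_lt_of_lt_one (show 0 < ε / (n * Q.side + 1) by
    have := Q.side_pos; positivity) (show (1 / 2 : ℝ) < 1 by norm_num)
  refine ⟨j, Set.eq_empty_of_forall_notMem fun y ⟨hy, hyE⟩ => hball ?_ hyE⟩
  have h1 := dist_le_of_mem hy (mem_cellAt hx)
  have hn : 0 ≤ (n : ℝ) * Q.side := mul_nonneg n.cast_nonneg Q.side_pos.le
  rw [lt_div_iff₀ (by positivity)] at hj
  have h2 : (n : ℝ) * (Q.cellAt j x).side = (1 / 2) ^ j * (n * Q.side) := by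
    rw [cellAt_side, one_div, inv_pow]; ring
  rw [h2] at h1
  have : 0 < (1 / 2 : ℝ) ^ j := by positivity
  rw [Metric.mem_ball]
  nlinarith

/-- The side length of the dyadic pore of `E` in `Q` that contains `x`. -/
def poreSide (E : Set (EuclideanSpace ℝ (Fin n))) (Q : HalfOpenCube n)
    (x : EuclideanSpace ℝ (Fin n)) : ℝ :=
  Q.side / 2 ^ sInf {j | (Q.cellAt j x).Misses E}

/-! ### The pore side as one function on all dyadic subcubes -/

section Pores

variable {E : Set (EuclideanSpace ℝ (Fin n))} {Q Q' : HalfOpenCube n}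
  {x : EuclideanSpace ℝ (Fin n)}

theorem poreSide_pos : 0 < Q.poreSide E x := cell_side_pos Q _

theorem poreSide_eq (h : Q' ∈ Q.stopping (Misses E)) (hx : x ∈ Q'.toSet) :
    Q.poreSide E x = Q'.side := by
  obtain ⟨j, rfl, hH, hi⟩ := exists_of_mem_stopping h hx
  have : sInf {j | (Q.cellAt j x).Misses E} = j :=
    le_antisymm (Nat.sInf_le hH) (le_csInf ⟨j, hH⟩ fun i hi' => not_lt.1 fun hlt => hi i hlt hi')
  rw [poreSide, this, cellAt_side]

theorem exists_mem_pore (hx : x ∈ Q.toSet) (hxE : x ∉ closure E) :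
    ∃ Q' ∈ Q.stopping (Misses E), x ∈ Q'.toSet :=
  exists_mem_stopping hx (exists_cellAt_misses hx hxE)

/-- All ancestors of `Q'` meet `closure E` because `Q'` does, so a cube maximal in `Q'` stays
maximal in `Q`. -/
theorem stopping_misses_subset (h : Q' ∈ Q.dyadic) (hQ' : (Q'.toSet ∩ closure E).Nonempty) :
    Q'.stopping (Misses E) ⊆ Q.stopping (Misses E) := by
  rintro _ ⟨x, hx, m, rfl, hm, hi⟩
  obtain ⟨j, hj⟩ := cellAt_of_mem_dyadic h
  have hxQ := subset_of_mem_dyadic h hx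
  have hjx := hj x hx
  refine ⟨x, hxQ, j + m, ?_, hm, fun i hlt => ?_⟩
  · rw [hjx, cellAt_cellAt hxQ]
  · rcases lt_or_ge i j with hij | hij
    · rw [hjx] at hQ'
      exact not_misses.2 (hQ'.mono (Set.inter_subset_inter_left _
        (cellAt_subset_cellAt hij.le hxQ)))
    · obtain ⟨l, rfl⟩ := Nat.exists_eq_add_of_le hij
      rw [← cellAt_cellAt hxQ, ← hjx]
      exact hi l (by omega)

theorem poreSide_of_mem_dyadic (h : Q' ∈ Q.dyadic) (hQ' : (Q'.toSet ∩ closure E).Nonempty)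
    (hx : x ∈ Q'.toSet) (hxE : x ∉ closure E) : Q'.poreSide E x = Q.poreSide E x := by
  obtain ⟨P, hP, hxP⟩ := exists_mem_pore hx hxE
  rw [poreSide_eq hP hxP, poreSide_eq (stopping_misses_subset h hQ' hP) hxP]

/-- A dyadic cube that misses `closure E` lies in a single pore. -/
theorem poreSide_eq_of_misses (h : Q' ∈ Q.dyadic) (hQ' : Q'.Misses E)
    (hx : x ∈ Q'.toSet) {y : EuclideanSpace ℝ (Fin n)} (hy : y ∈ Q'.toSet) :
    Q.poreSide E y = Q.poreSide E x := by
  obtain ⟨j, hj⟩ := cellAt_of_mem_dyadic h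
  have hxQ := subset_of_mem_dyadic h hx
  obtain ⟨P, hP, hxP⟩ := exists_mem_stopping (H := Misses E) hxQ ⟨j, hj x hx ▸ hQ'⟩
  obtain ⟨m, rfl, hm, hi⟩ := exists_of_mem_stopping hP hxP
  have hmj : m ≤ j := not_lt.1 fun hlt => hi j hlt (hj x hx ▸ hQ')
  have hyP : y ∈ (Q.cellAt m x).toSet := cellAt_subset_cellAt hmj hxQ (hj x hx ▸ hy)
  rw [poreSide_eq hP hxP, poreSide_eq hP hyP]

end Pores

end HalfOpenCube

/-- Exponential decay of the distribution function of `g` bounds its exponential integrals. -/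
theorem lintegral_exp_le_of_decay {α : Type*} [MeasurableSpace α] {μ : Measure α} {g : α → ℝ}
    {b K τ q : ℝ} {M : ℝ≥0∞} (hK : 0 < K) (hτ : 0 ≤ τ) (hq : 0 ≤ q)
    (hτq : Real.exp (τ * K) * q < 1)
    (h : ∀ k : ℕ, μ {x | b + k * K < g x} ≤ ENNReal.ofReal (q ^ k) * M) (hM : μ Set.univ ≤ M) :
    ∫⁻ x, ENNReal.ofReal (Real.exp (τ * g x)) ∂μ ≤
      ENNReal.ofReal (Real.exp (τ * b)) *
        (ENNReal.ofReal (1 + Real.exp (τ * K) / (1 - Real.exp (τ * K) * q)) * M) := by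
  set e := Real.exp (τ * K) with he
  have he0 : 0 < e := Real.exp_pos _
  -- `g` is not assumed measurable, so superlevel sets are replaced by measurable hulls of equal
  -- measure.
  set T : ℕ → Set α := fun k => toMeasurable μ {x | b + k * K < g x} with hT
  have hpt : ∀ x, ENNReal.ofReal (Real.exp (τ * g x)) ≤ ENNReal.ofReal (Real.exp (τ * b)) *
      (1 + ∑' k : ℕ, (T k).indicator (fun _ => ENNReal.ofReal (e ^ (k + 1))) x) := by
    intro x
    rcases le_or_gt (g x) b with hx | hx
    · calc ENNReal.ofReal (Real.exp (τ * g x)) ≤ ENNReal.ofReal (Real.exp (τ * b)) * 1 := by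
            rw [mul_one]; gcongr
        _ ≤ _ := by gcongr; exact le_self_add
    -- This `k` satisfies b + kK < g x ≤ b + (k+1)K.
    · obtain ⟨k, hk⟩ : ∃ k : ℕ, ⌈(g x - b) / K⌉₊ = k + 1 :=
        Nat.exists_eq_succ_of_ne_zero (Nat.ceil_pos.2 (div_pos (sub_pos.2 hx) hK)).ne'
      have h1 : (g x - b) / K ≤ k + 1 := by
        have := Nat.le_ceil ((g x - b) / K)
        rw [hk] at this; exact_mod_cast this
      have h2 : (k : ℝ) < (g x - b) / K := Nat.lt_ceil.1 (by omega)
      rw [div_le_iff₀ hK] at h1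
      rw [lt_div_iff₀ hK] at h2
      have hxT : x ∈ T k := subset_toMeasurable _ _ (show b + k * K < g x by linarith)
      calc ENNReal.ofReal (Real.exp (τ * g x))
          ≤ ENNReal.ofReal (Real.exp (τ * b) * e ^ (k + 1)) := by
            rw [he, ← Real.exp_nat_mul, ← Real.exp_add]
            gcongr
            push_cast
            nlinarith
        _ = ENNReal.ofReal (Real.exp (τ * b)) *
            (T k).indicator (fun _ => ENNReal.ofReal (e ^ (k + 1))) x := by
            rw [Set.indicator_of_mem hxT, ENNReal.ofReal_mul (Real.exp_pos _).le]
        _ ≤ _ := by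
            gcongr
            exact (ENNReal.le_tsum (f := fun k : ℕ =>
              (T k).indicator (fun _ => ENNReal.ofReal (e ^ (k + 1))) x) k).trans le_add_self
  refine (lintegral_mono hpt).trans ?_
  rw [lintegral_const_mul' _ _ ENNReal.ofReal_ne_top]
  gcongr
  rw [lintegral_add_left measurable_const, lintegral_tsum fun k =>
    (measurable_const.indicator (measurableSet_toMeasurable _ _)).aemeasurable]
  have h1q : 0 < 1 - e * q := sub_pos.2 hτq
  have hgeo : ∑' k : ℕ, ENNReal.ofReal (e * (e * q) ^ k) = ENNReal.ofReal (e / (1 - e * q)) := by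
    rw [← ENNReal.ofReal_tsum_of_nonneg (fun k => by positivity)
      ((summable_geometric_of_lt_one (by positivity) hτq).mul_left _), tsum_mul_left,
      tsum_geometric_of_lt_one (by positivity) hτq, div_eq_mul_inv]
  rw [ENNReal.ofReal_add zero_le_one (by positivity), ENNReal.ofReal_one, add_mul, ← hgeo,
    ← ENNReal.tsum_mul_right]
  refine add_le_add (by simpa using hM) (ENNReal.tsum_le_tsum fun k => ?_)
  rw [lintegral_indicator_const (measurableSet_toMeasurable _ _), measure_toMeasurable]
  calc _ ≤ ENNReal.ofReal (e ^ (k + 1)) * (ENNReal.ofReal (q ^ k) * M) := by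
        gcongr; exact h k
    _ = _ := by
        rw [← mul_assoc, ← ENNReal.ofReal_mul (by positivity)]
        congr 2
        ring

/-! ### John–Nirenberg decay and nullity of the closure -/

namespace HalfOpenCube

variable {n : ℕ}

/-- Neither `A` nor `B` need be measurable: the sum over the cubes is taken for the measure
`volume.restrict A`, for which measurability of the cubes suffices. -/
theorem volume_le_mul_of_forall_mem {S : Set (HalfOpenCube n)} (hS : S.Countable)
    (hd : S.PairwiseDisjoint toSet) {A B : Set (EuclideanSpace ℝ (Fin n))} {c : ℝ≥0∞}
    (h : ∀ Q ∈ S, volume (B ∩ Q.toSet) ≤ c * volume (A ∩ Q.toSet))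
    (hB : volume (B \ ⋃ Q ∈ S, Q.toSet) = 0) : volume B ≤ c * volume A := by
  have := hS.to_subtype
  calc volume B ≤ volume (B ∩ ⋃ Q ∈ S, Q.toSet) + volume (B \ ⋃ Q ∈ S, Q.toSet) :=
        measure_le_inter_add_sdiff _ _ _
    _ = volume (⋃ Q : S, B ∩ Q.1.toSet) := by
        rw [hB, add_zero, Set.biUnion_eq_iUnion, Set.inter_iUnion]
    _ ≤ ∑' Q : S, volume (B ∩ Q.1.toSet) := measure_iUnion_le _
    _ ≤ ∑' Q : S, c * volume (A ∩ Q.1.toSet) := ENNReal.tsum_le_tsum fun Q => h _ Q.2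
    _ = c * ∑' Q : S, (volume.restrict A) Q.1.toSet := by
        rw [ENNReal.tsum_mul_left]
        congr 2 with Q
        rw [Measure.restrict_apply Q.1.measurableSet_toSet, Set.inter_comm]
    _ = c * (volume.restrict A) (⋃ Q ∈ S, Q.toSet) := by
        rw [measure_biUnion hS hd fun Q _ => Q.measurableSet_toSet]
    _ ≤ c * volume A := by
        refine mul_le_mul_right ?_ c
        exact (measure_mono (Set.subset_univ _)).trans_eq (Measure.restrict_apply_univ _)

theorem volume_cellAt_succ (Q : HalfOpenCube n) (j : ℕ) (x : EuclideanSpace ℝ (Fin n)) :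
    volume (Q.cellAt j x).toSet =
      ENNReal.ofReal (2 ^ n * (Q.cellAt (j + 1) x).side ^ n) := by
  rw [volume_toSet, cellAt_side, cellAt_side, pow_succ, ← mul_pow]
  congr 2
  field_simp

/-- The local oscillation form of the John–Nirenberg inequality, one-sided, on a dyadic system. -/
theorem volume_superlevel_le {Q₀ : HalfOpenCube n} {f : EuclideanSpace ℝ (Fin n) → ℝ}
    {s σ K : ℝ} (hK : 0 ≤ K) (hs : 0 ≤ s) (hσ : 0 < σ) (hsσ : s ≤ σ) (hσn : 2 ^ n * σ + s < 1)
    {a b : HalfOpenCube n → ℝ} (hab : ∀ Q ∈ Q₀.dyadic, b Q ≤ a Q + K)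
    (hb : ∀ Q ∈ Q₀.dyadic, volume {x ∈ Q.toSet | b Q < f x} ≤ ENNReal.ofReal s * volume Q.toSet)
    (ha : ∀ Q ∈ Q₀.dyadic, volume {x ∈ Q.toSet | f x < a Q} ≤ ENNReal.ofReal s * volume Q.toSet)
    (hf : ∀ᵐ x, x ∈ Q₀.toSet → ∃ j, ∀ y ∈ (Q₀.cellAt j x).toSet, f y = f x) (k : ℕ) :
    ∀ Q ∈ Q₀.dyadic, volume {x ∈ Q.toSet | b Q + k * K < f x} ≤
      ENNReal.ofReal ((s / σ) ^ k) * volume Q.toSet := by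
  induction k with
  | zero =>
    intro Q _
    simpa using measure_mono (μ := volume)
      (Set.sep_subset Q.toSet fun x => b Q < f x)
  | succ k ih =>
    intro Q hQ
    set A := {x ∈ Q.toSet | b Q < f x} with hA
    set heavy : HalfOpenCube n → Prop := fun P =>
      ENNReal.ofReal σ * volume P.toSet < volume (A ∩ P.toSet) with hheavy
    have hnot : ¬heavy Q := by
      simp only [hheavy, not_lt]
      calc volume (A ∩ Q.toSet) ≤ volume A := measure_mono Set.inter_subset_left
        _ ≤ _ := hb Q hQ
        _ ≤ _ := by gcongr
    have hsel : ∀ P ∈ Q.stopping heavy, b P ≤ b Q + K := by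
      intro P hP
      have hPQ₀ := dyadic_trans hQ (stopping_subset_dyadic hP)
      obtain ⟨x, hx, j, rfl, hH, hi⟩ := hP
      rcases j with _ | j
      · rw [cellAt_zero hx] at hH
        exact absurd hH hnot
      refine (hab _ hPQ₀).trans ?_
      gcongr
      by_contra! hlt
      -- The father is not heavy, and its volume is 2ⁿ times that of the selected cube.
      have hpar := not_lt.1 (hi j (Nat.lt_succ_self j))
      set P := Q.cellAt (j + 1) x with hP
      have hp : 0 < P.side ^ n := pow_pos P.side_pos n
      -- If a(P) > b(Q), each point of P is above b(Q) or below a(P). These two sets cover at most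
      -- the fraction 2ⁿσ + s < 1 of P, a contradiction.
      have hsub : P.toSet ⊆ (A ∩ (Q.cellAt j x).toSet) ∪ {y ∈ P.toSet | f y < a P} := by
        intro y hy
        rcases lt_or_ge (b Q) (f y) with h | h
        · exact Or.inl ⟨⟨cellAt_subset hx _ hy, h⟩, cellAt_subset_cellAt (Nat.le_succ j) hx hy⟩
        · exact Or.inr ⟨hy, h.trans_lt hlt⟩
      have hle := (measure_mono hsub).trans ((measure_union_le _ _).trans
        (add_le_add hpar (ha _ hPQ₀)))
      rw [volume_cellAt_succ Q j, volume_toSet, ← hP, ← ENNReal.ofReal_mul hσ.le,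
        ← ENNReal.ofReal_mul hs, ← ENNReal.ofReal_add (by positivity) (by positivity),
        ENNReal.ofReal_le_ofReal_iff (by positivity)] at hle
      nlinarith
    have key : volume {x ∈ Q.toSet | b Q + (k + 1 : ℕ) * K < f x} ≤
        ENNReal.ofReal ((s / σ) ^ k / σ) * volume A := by
      refine volume_le_mul_of_forall_mem countable_stopping
        (pairwiseDisjoint_stopping (Q := Q) (H := heavy)) (fun P hP => ?_) ?_
      · have hH : heavy P := by obtain ⟨x, hx, j, rfl, hH, hi⟩ := hP; exact hH
        calc _ ≤ volume {x ∈ P.toSet | b P + k * K < f x} := by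
              refine measure_mono ?_
              rintro x ⟨⟨_, hx⟩, hxP⟩
              refine ⟨hxP, ?_⟩
              have := hsel P hP
              push_cast at hx
              linarith
          _ ≤ _ := ih P (dyadic_trans hQ (stopping_subset_dyadic hP))
          _ = ENNReal.ofReal ((s / σ) ^ k / σ) * (ENNReal.ofReal σ * volume P.toSet) := by
              rw [← mul_assoc, ← ENNReal.ofReal_mul' hσ.le, div_mul_cancel₀ _ hσ.ne']
          _ ≤ _ := by gcongr
      -- Local constancy of `f` takes the place of Lebesgue's density theorem: a whole cell around
      -- almost every such point lies in A, and it is heavy because σ < 1.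
      · refine measure_mono_null (fun x hx => ?_) (ae_iff.1 hf)
        intro hx'
        obtain ⟨⟨hxQ, hbx⟩, hxU⟩ := hx
        obtain ⟨j, hj⟩ := hx' (subset_of_mem_dyadic hQ hxQ)
        refine hxU ?_
        obtain ⟨i, hi⟩ := cellAt_of_mem_dyadic hQ
        have hQi := hi x hxQ
        have hxQ₀ := subset_of_mem_dyadic hQ hxQ
        have hcell : (Q.cellAt j x).toSet ⊆ (Q₀.cellAt j x).toSet := by
          rw [hQi, cellAt_cellAt hxQ₀]
          exact cellAt_subset_cellAt (Nat.le_add_left _ _) hxQ₀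
        have hH : heavy (Q.cellAt j x) := by
          have hsub : A ∩ (Q.cellAt j x).toSet = (Q.cellAt j x).toSet := by
            refine Set.inter_eq_right.2 fun y hy => ⟨cellAt_subset hxQ j hy, ?_⟩
            rw [hj y (hcell hy)]
            push_cast at hbx
            nlinarith [mul_nonneg (by positivity : (0 : ℝ) ≤ k + 1) hK]
          have hσ1 : σ < 1 := by
            have : (1 : ℝ) ≤ 2 ^ n := one_le_pow₀ one_le_two
            nlinarith
          rw [hheavy]
          simp only [hsub]
          rw [volume_toSet, ← ENNReal.ofReal_mul hσ.le]
          have hp : 0 < (Q.cellAt j x).side ^ n := pow_pos (side_pos _) n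
          exact (ENNReal.ofReal_lt_ofReal_iff hp).2 (by nlinarith)
        obtain ⟨P, hP, hxP⟩ := exists_mem_stopping hxQ ⟨j, hH⟩
        exact Set.mem_biUnion hP hxP
    refine key.trans ?_
    calc _ ≤ ENNReal.ofReal ((s / σ) ^ k / σ) * (ENNReal.ofReal s * volume Q.toSet) := by
          gcongr; exact hb Q hQ
      _ = _ := by
          rw [← mul_assoc, ← ENNReal.ofReal_mul (by positivity)]
          congr 2
          rw [pow_succ]
          ring

theorem eq_iUnion_cells (E : Set (EuclideanSpace ℝ (Fin n))) (Q : HalfOpenCube n) (j : ℕ) :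
    {x ∈ Q.toSet | ¬(Q.cellAt j x).Misses E} =
      ⋃ P ∈ {P ∈ Q.dyadicGen j | ¬P.Misses E}, P.toSet := by
  ext x
  simp only [Set.mem_iUnion, exists_prop]
  constructor
  · rintro ⟨hx, h⟩
    exact ⟨_, ⟨cellAt_mem_dyadicGen hx j, h⟩, mem_cellAt hx⟩
  · rintro ⟨P, ⟨hP, h⟩, hx⟩
    rw [eq_cellAt hP hx] at h
    exact ⟨subset_of_mem_dyadicGen hP hx, h⟩

/-- The generation-j cells meeting `closure E` decrease to `closure E ∩ Q`. Summing the hypothesis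
over them and letting j tend to infinity gives a finite measure bounded by c < 1 times itself. -/
theorem volume_closure_inter_eq_zero {E : Set (EuclideanSpace ℝ (Fin n))} {c : ℝ≥0∞} (hc : c < 1)
    (h : ∀ Q : HalfOpenCube n, (Q.toSet ∩ closure E).Nonempty →
      volume (closure E ∩ Q.toSet) ≤ c * volume Q.toSet) (Q : HalfOpenCube n) :
    volume (closure E ∩ Q.toSet) = 0 := by
  set G : ℕ → Set (EuclideanSpace ℝ (Fin n)) :=
    fun j => {x ∈ Q.toSet | ¬(Q.cellAt j x).Misses E} with hG
  have hcount : ∀ j, {P ∈ Q.dyadicGen j | ¬P.Misses E}.Countable := fun j =>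
    Q.countable_dyadic.mono fun P hP => show P ∈ Q.dyadic from ⟨j, hP.1⟩
  have hGm : ∀ j, MeasurableSet (G j) := fun j => by
    rw [hG]
    simp only [eq_iUnion_cells]
    exact MeasurableSet.biUnion (hcount j) fun P _ => P.measurableSet_toSet
  have hanti : Antitone G := by
    rintro i j hij x ⟨hx, hx'⟩
    exact ⟨hx, not_misses.2 ((not_misses.1 hx').mono (Set.inter_subset_inter_left _
      (cellAt_subset_cellAt hij hx)))⟩
  have hsub : ∀ j, closure E ∩ Q.toSet ⊆ G j := fun j x hx =>
    ⟨hx.2, not_misses.2 ⟨x, mem_cellAt hx.2, hx.1⟩⟩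
  have hInter : ⋂ j, G j = closure E ∩ Q.toSet := by
    refine subset_antisymm (fun x hx => ?_) (Set.subset_iInter hsub)
    have hxQ := (Set.mem_iInter.1 hx 0).1
    refine ⟨?_, hxQ⟩
    by_contra hxE
    obtain ⟨j, hj⟩ := exists_cellAt_misses hxQ hxE
    exact (Set.mem_iInter.1 hx j).2 hj
  have hle : ∀ j, volume (closure E ∩ Q.toSet) ≤ c * volume (G j) := by
    intro j
    refine volume_le_mul_of_forall_mem (hcount j) ?_ (fun P hP => ?_) ?_
    · rintro P ⟨hP, -⟩ P' ⟨hP', -⟩ hne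
      exact Set.disjoint_left.2 fun x hx hx' =>
        hne ((eq_cellAt hP hx).trans (eq_cellAt hP' hx').symm)
    · have hPG : G j ∩ P.toSet = P.toSet := by
        rw [Set.inter_eq_right, hG]
        simp only [eq_iUnion_cells]
        exact Set.subset_biUnion_of_mem (s := {P ∈ Q.dyadicGen j | ¬P.Misses E}) (u := toSet) hP
      rw [hPG]
      exact (measure_mono (Set.inter_subset_inter_left _ Set.inter_subset_left)).trans
        (h P (not_misses.1 hP.2))
    · rw [← eq_iUnion_cells, Set.sdiff_eq_empty.2 (hsub j), measure_empty]
  have hfin : volume (closure E ∩ Q.toSet) ≠ ∞ :=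
    measure_ne_top_of_subset Set.inter_subset_right Q.volume_toSet_ne_top
  have hlim := tendsto_measure_iInter_atTop (μ := volume) (fun j => (hGm j).nullMeasurableSet)
    hanti ⟨0, measure_ne_top_of_subset (Set.sep_subset _ _) Q.volume_toSet_ne_top⟩
  rw [hInter] at hlim
  have hle' : volume (closure E ∩ Q.toSet) ≤ c * volume (closure E ∩ Q.toSet) :=
    ge_of_tendsto' (ENNReal.Tendsto.const_mul hlim (Or.inr (hc.trans ENNReal.one_lt_top).ne)) hle
  by_contra h0
  refine absurd hle' (not_le.2 ?_)
  calc c * volume (closure E ∩ Q.toSet) < 1 * volume (closure E ∩ Q.toSet) :=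
        (ENNReal.mul_lt_mul_iff_left h0 hfin).2 hc
    _ = _ := one_mul _

theorem volume_eq_zero_of_forall {A : Set (EuclideanSpace ℝ (Fin n))}
    (h : ∀ Q : HalfOpenCube n, volume (A ∩ Q.toSet) = 0) : volume A = 0 := by
  let Q : ℕ → HalfOpenCube n := fun N =>
    ⟨WithLp.toLp 2 fun _ => -((N : ℝ) + 1), 2 * (N + 1), by positivity⟩
  have hA : A = ⋃ N, A ∩ (Q N).toSet := by
    rw [← Set.inter_iUnion, eq_comm, Set.inter_eq_left]
    intro x _
    obtain ⟨N, hN⟩ := exists_nat_ge ‖x‖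
    refine Set.mem_iUnion.2 ⟨N, fun i => ?_⟩
    have := (PiLp.norm_apply_le x i).trans hN
    rw [Real.norm_eq_abs, abs_le] at this
    constructor
    · simp only [Q]; linarith
    · simp only [Q]; linarith
  rw [hA]
  exact measure_iUnion_null fun N => h _

end HalfOpenCube

/-! ### Distance to the set against the size of pores -/

namespace HalfOpenCube

variable {n : ℕ}

section Pores

variable {E : Set (EuclideanSpace ℝ (Fin n))} {Q Q' : HalfOpenCube n}
  {x : EuclideanSpace ℝ (Fin n)} {s L : ℝ}

theorem infDist_le_of_meets (hQ : (Q.toSet ∩ closure E).Nonempty) (hx : x ∈ Q.toSet) :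
    Metric.infDist x E ≤ n * Q.side := by
  obtain ⟨y, hy, hyE⟩ := hQ
  rw [← Metric.infDist_closure]
  exact (Metric.infDist_le_dist_of_mem hyE).trans (dist_le_of_mem hx hy)

/-- The father has twice the side and meets `closure E`. -/
theorem infDist_le_of_mem_pore (hQ : (Q.toSet ∩ closure E).Nonempty)
    (hQ' : Q' ∈ Q.stopping (Misses E)) (hx : x ∈ Q'.toSet) :
    Metric.infDist x E ≤ 2 * n * Q'.side := by
  have hxQ := subset_of_mem_dyadic (stopping_subset_dyadic hQ') hx
  obtain ⟨j, rfl, hH, hi⟩ := exists_of_mem_stopping hQ' hx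
  rcases j with _ | j
  · rw [cellAt_zero hxQ] at hH
    exact absurd hH (not_misses.2 hQ)
  · refine (infDist_le_of_meets (not_misses.1 (hi j (Nat.lt_succ_self j)))
      (mem_cellAt hxQ)).trans_eq ?_
    rw [cellAt_side, cellAt_side, pow_succ]
    field_simp

theorem le_infDist_of_misses (hE : E.Nonempty) (hQ : Q.Misses E) {r : ℝ}
    (hx : ∀ i, Q.corner i + r ≤ x i ∧ x i + r ≤ Q.corner i + Q.side) :
    r ≤ Metric.infDist x E := by
  refine (Metric.le_infDist hE).2 fun y hy => ?_
  by_contra! hlt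
  refine (Set.eq_empty_iff_forall_notMem.1 hQ y) ⟨fun i => ?_, subset_closure hy⟩
  have h : |x i - y i| < r := by
    have := (PiLp.norm_apply_le (x - y) i).trans_lt (by rwa [← dist_eq_norm])
    simpa using this
  rw [abs_lt] at h
  constructor <;> linarith [(hx i).1, (hx i).2]

theorem infDist_pos_of_notMem (hE : E.Nonempty) (hx : x ∉ closure E) :
    0 < Metric.infDist x E := by
  rw [← Metric.infDist_closure]
  exact (isClosed_closure.notMem_iff_infDist_pos hE.closure).1 hx

/-- The concentric subcube at relative distance `t` from the complement. -/
def inner (Q : HalfOpenCube n) (t : ℝ) (ht : t < 1 / 2) : HalfOpenCube n where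
  corner := WithLp.toLp 2 fun i => Q.corner i + t * Q.side
  side := (1 - 2 * t) * Q.side
  side_pos := mul_pos (by linarith) Q.side_pos

theorem inner_subset {t : ℝ} (ht0 : 0 ≤ t) (ht : t < 1 / 2) : (Q.inner t ht).toSet ⊆ Q.toSet := by
  intro x hx i
  have := hx i
  simp only [inner] at this
  have := mul_nonneg ht0 Q.side_pos.le
  constructor <;> linarith

theorem le_infDist_of_mem_inner (hE : E.Nonempty) (hQ : Q.Misses E) {t : ℝ} (ht : t < 1 / 2)
    (hx : x ∈ (Q.inner t ht).toSet) : t * Q.side ≤ Metric.infDist x E := by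
  refine le_infDist_of_misses hE hQ fun i => ?_
  have := hx i
  simp only [inner] at this
  constructor <;> linarith

theorem volume_inner {t : ℝ} (ht : t < 1 / 2) :
    volume (Q.inner t ht).toSet = ENNReal.ofReal ((1 - 2 * t) ^ n) * volume Q.toSet := by
  rw [volume_toSet, volume_toSet, ← ENNReal.ofReal_mul (pow_nonneg (by linarith) n), ← mul_pow]
  rfl

/-- The points covered by the pores of `E` in `Q` that satisfy `p`. -/
def poreUnion (E : Set (EuclideanSpace ℝ (Fin n))) (Q : HalfOpenCube n)
    (p : HalfOpenCube n → Prop) : Set (EuclideanSpace ℝ (Fin n)) :=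
  ⋃ P ∈ {P ∈ Q.stopping (Misses E) | p P}, P.toSet

theorem mem_poreUnion {p : HalfOpenCube n → Prop} :
    x ∈ poreUnion E Q p ↔ ∃ P ∈ Q.stopping (Misses E), p P ∧ x ∈ P.toSet := by
  simp [poreUnion, and_assoc]

theorem volume_poreUnion (p : HalfOpenCube n → Prop) :
    volume (poreUnion E Q p) = ∑' P : {P // P ∈ Q.stopping (Misses E) ∧ p P},
      volume P.1.toSet :=
  measure_biUnion (countable_stopping.mono (Set.sep_subset _ _))
    (pairwiseDisjoint_stopping.subset (Set.sep_subset _ _)) fun P _ => P.measurableSet_toSet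

theorem measurableSet_poreUnion (p : HalfOpenCube n → Prop) :
    MeasurableSet (poreUnion E Q p) :=
  MeasurableSet.biUnion (countable_stopping.mono (Set.sep_subset _ _))
    fun P _ => P.measurableSet_toSet

theorem poreUnion_subset (p : HalfOpenCube n → Prop) : poreUnion E Q p ⊆ Q.toSet \ closure E := by
  intro x hx
  obtain ⟨P, hP, -, hxP⟩ := mem_poreUnion.1 hx
  refine ⟨subset_of_mem_dyadic (stopping_subset_dyadic hP) hxP, fun hxE => ?_⟩
  obtain ⟨_, _, _, _, hH, _⟩ := hP
  exact Set.eq_empty_iff_forall_notMem.1 hH x ⟨hxP, hxE⟩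

theorem mem_largePoreSet_iff (hQ : (Q.toSet ∩ closure E).Nonempty) :
    L ∈ largePoreSet s Q E ↔ 0 ≤ L ∧
      ENNReal.ofReal s * volume Q.toSet ≤ volume (poreUnion E Q fun P => L ≤ P.side) := by
  rw [largePoreSet, dyadicPores_eq_stopping hQ, volume_poreUnion]
  rfl

theorem mem_smallPoreSet_iff (hQ : (Q.toSet ∩ closure E).Nonempty) :
    L ∈ smallPoreSet s Q E ↔ 0 ≤ L ∧
      ENNReal.ofReal s * volume Q.toSet ≤ volume (poreUnion E Q fun P => P.side ≤ L) := by
  rw [smallPoreSet, dyadicPores_eq_stopping hQ, volume_poreUnion]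
  rfl

theorem mul_volume_poreUnion_le {p : HalfOpenCube n → Prop} {c : ℝ≥0∞}
    {g : EuclideanSpace ℝ (Fin n) → ℝ≥0∞}
    (h : ∀ P ∈ Q.stopping (Misses E), p P → c * volume P.toSet ≤ ∫⁻ x in P.toSet, g x) :
    c * volume (poreUnion E Q p) ≤ ∫⁻ x in Q.toSet, g x := by
  calc c * volume (poreUnion E Q p)
      = ∑' P : {P // P ∈ Q.stopping (Misses E) ∧ p P}, c * volume P.1.toSet := by
        rw [volume_poreUnion, ENNReal.tsum_mul_left]
    _ ≤ ∑' P : {P // P ∈ Q.stopping (Misses E) ∧ p P}, ∫⁻ x in P.1.toSet, g x :=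
        ENNReal.tsum_le_tsum fun P => h _ P.2.1 P.2.2
    _ = ∫⁻ x in poreUnion E Q p, g x :=
        (lintegral_biUnion (countable_stopping.mono (Set.sep_subset _ _))
          (fun P _ => P.measurableSet_toSet)
          (pairwiseDisjoint_stopping.subset (Set.sep_subset _ _)) _).symm
    _ ≤ _ := lintegral_mono_set ((poreUnion_subset p).trans Set.sdiff_subset)

/-- The distance may be small near the boundary of `Q`; only the central cube of half the side is
used, where it is at least a quarter of the side. -/
theorem mul_volume_le_lintegral_infDist_rpow (hE : E.Nonempty) (hQ : Q.Misses E) {τ : ℝ}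
    (hτ : 0 ≤ τ) (hL0 : 0 ≤ L) (hL : L ≤ Q.side) :
    ENNReal.ofReal ((1 / 2) ^ n * (1 / 4 * L) ^ τ) * volume Q.toSet ≤
      ∫⁻ x in Q.toSet, ENNReal.ofReal (Metric.infDist x E ^ τ) := by
  have ht : (1 / 4 : ℝ) < 1 / 2 := by norm_num
  calc _ = ENNReal.ofReal ((1 / 4 * L) ^ τ) * volume (Q.inner (1 / 4) ht).toSet := by
        rw [volume_inner, mul_comm ((1 / 2 : ℝ) ^ n), ENNReal.ofReal_mul (by positivity), mul_assoc]
        norm_num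
    _ = ∫⁻ x in (Q.inner (1 / 4) ht).toSet, ENNReal.ofReal ((1 / 4 * L) ^ τ) := by
        rw [setLIntegral_const]
    _ ≤ ∫⁻ x in (Q.inner (1 / 4) ht).toSet, ENNReal.ofReal (Metric.infDist x E ^ τ) := by
        refine setLIntegral_mono' (measurableSet_toSet _) fun x hx => ?_
        gcongr
        exact (by gcongr : 1 / 4 * L ≤ 1 / 4 * Q.side).trans (le_infDist_of_mem_inner hE hQ ht hx)
    _ ≤ _ := lintegral_mono_set (inner_subset (by norm_num) ht)

theorem mul_volume_le_lintegral_infDist_rpow_neg (hE : E.Nonempty)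
    (hQ : (Q.toSet ∩ closure E).Nonempty) (hQ' : Q' ∈ Q.stopping (Misses E)) {τ : ℝ}
    (hτ : 0 ≤ τ) (hL : Q'.side ≤ L) :
    ENNReal.ofReal ((2 * n * L) ^ (-τ)) * volume Q'.toSet ≤
      ∫⁻ x in Q'.toSet, ENNReal.ofReal (Metric.infDist x E ^ (-τ)) := by
  rw [← setLIntegral_const]
  refine setLIntegral_mono' (measurableSet_toSet _) fun x hx => ?_
  have hxE : x ∉ closure E := fun hxE =>
    (poreUnion_subset (fun _ => True) (mem_poreUnion.2 ⟨Q', hQ', trivial, hx⟩)).2 hxE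
  refine ENNReal.ofReal_le_ofReal (Real.rpow_le_rpow_of_nonpos (infDist_pos_of_notMem hE hxE)
    ((infDist_le_of_mem_pore hQ hQ' hx).trans ?_) (by linarith))
  gcongr

theorem diff_subset_poreUnion_true :
    Q.toSet \ closure E ⊆ poreUnion E Q fun _ => True := by
  rintro x ⟨hx, hxE⟩
  obtain ⟨P, hP, hxP⟩ := exists_mem_pore hx hxE
  exact mem_poreUnion.2 ⟨P, hP, trivial, hxP⟩

theorem volume_poreUnion_true (hE0 : volume (closure E) = 0) :
    volume (poreUnion E Q fun _ => True) = volume Q.toSet := by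
  refine le_antisymm (measure_mono ((poreUnion_subset _).trans Set.sdiff_subset)) ?_
  rw [← measure_sdiff_null hE0]
  exact measure_mono diff_subset_poreUnion_true

/-- Pores of side at least 1/(N+1) exhaust `Q` up to a null set, so for large N they exceed the
fraction s < 1. This keeps the numerator of the ratio positive. -/
theorem exists_mem_largePoreSet (hQ : (Q.toSet ∩ closure E).Nonempty)
    (hE0 : volume (closure E) = 0) (hs : s < 1) : ∃ L ∈ largePoreSet s Q E, 0 < L := by
  set V : ℕ → Set (EuclideanSpace ℝ (Fin n)) :=
    fun N => poreUnion E Q fun P => 1 / ((N : ℝ) + 1) ≤ P.side with hV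
  have hmono : Monotone V := by
    intro N M hNM x hx
    obtain ⟨P, hP, hs, hxP⟩ := mem_poreUnion.1 hx
    exact mem_poreUnion.2 ⟨P, hP, (Nat.one_div_le_one_div hNM).trans hs, hxP⟩
  have hU : (poreUnion E Q fun _ => True) = ⋃ N, V N := by
    ext x
    rw [Set.mem_iUnion, mem_poreUnion]
    constructor
    · rintro ⟨P, hP, -, hx⟩
      obtain ⟨N, hN⟩ := exists_nat_one_div_lt P.side_pos
      exact ⟨N, mem_poreUnion.2 ⟨P, hP, hN.le, hx⟩⟩
    · rintro ⟨N, hx⟩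
      obtain ⟨P, hP, -, hxP⟩ := mem_poreUnion.1 hx
      exact ⟨P, hP, trivial, hxP⟩
  have hlt : ENNReal.ofReal s * volume Q.toSet < ⨆ N, volume (V N) := by
    rw [← hmono.measure_iUnion, ← hU, volume_poreUnion_true hE0]
    calc _ < 1 * volume Q.toSet :=
          (ENNReal.mul_lt_mul_iff_left Q.volume_toSet_ne_zero Q.volume_toSet_ne_top).2
            (ENNReal.ofReal_lt_one.2 hs)
      _ = _ := one_mul _
  obtain ⟨N, hN⟩ := lt_iSup_iff.1 hlt
  exact ⟨1 / ((N : ℝ) + 1), (mem_largePoreSet_iff hQ).2 ⟨by positivity, hN.le⟩, by positivity⟩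

theorem side_le_of_mem_dyadic (h : Q' ∈ Q.dyadic) : Q'.side ≤ Q.side := by
  obtain ⟨j, hj⟩ := h
  rw [hj.1]
  exact div_le_self Q.side_pos.le (one_le_pow₀ one_le_two)

theorem side_mem_smallPoreSet (hQ : (Q.toSet ∩ closure E).Nonempty)
    (hE0 : volume (closure E) = 0) (hs : s ≤ 1) : Q.side ∈ smallPoreSet s Q E := by
  refine (mem_smallPoreSet_iff hQ).2 ⟨Q.side_pos.le, ?_⟩
  calc _ ≤ 1 * volume Q.toSet := by
        gcongr
        exact ENNReal.ofReal_le_one.2 hs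
    _ = volume (poreUnion E Q fun _ => True) := by rw [one_mul, volume_poreUnion_true hE0]
    _ ≤ _ := by
        refine measure_mono fun x hx => ?_
        obtain ⟨P, hP, -, hxP⟩ := mem_poreUnion.1 hx
        exact mem_poreUnion.2 ⟨P, hP, side_le_of_mem_dyadic (stopping_subset_dyadic hP), hxP⟩

theorem pos_of_mem_smallPoreSet (hQ : (Q.toSet ∩ closure E).Nonempty) (hs : 0 < s)
    (hL : L ∈ smallPoreSet s Q E) : 0 < L := by
  obtain ⟨-, h⟩ := (mem_smallPoreSet_iff hQ).1 hL
  by_contra! hL0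
  have : (poreUnion E Q fun P => P.side ≤ L) = ∅ := by
    refine Set.eq_empty_of_forall_notMem fun x hx => ?_
    obtain ⟨P, -, h, -⟩ := mem_poreUnion.1 hx
    linarith [P.side_pos]
  rw [this, measure_empty, nonpos_iff_eq_zero, mul_eq_zero] at h
  rcases h with h | h
  · exact absurd (ENNReal.ofReal_eq_zero.1 h) (not_le.2 hs)
  · exact Q.volume_toSet_ne_zero h

theorem poreRatio_pos_and_le {C₀ : ℝ} (hC₀ : 0 < C₀) (hL : ∃ L ∈ largePoreSet s Q E, 0 < L)
    (hS : (smallPoreSet s Q E).Nonempty)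
    (h : ∀ L ∈ largePoreSet s Q E, ∀ L' ∈ smallPoreSet s Q E, L ≤ C₀ * L') :
    0 < poreRatio s Q E ∧ poreRatio s Q E ≤ ENNReal.ofReal C₀ := by
  constructor
  · obtain ⟨L, hL, hL0⟩ := hL
    obtain ⟨L', hL'⟩ := hS
    refine ENNReal.div_pos (ne_of_gt ?_) (ne_of_lt ?_)
    · exact (ENNReal.ofReal_pos.2 hL0).trans_le (le_iSup₂ (f := fun L _ => ENNReal.ofReal L) L hL)
    · exact (iInf₂_le (f := fun L _ => ENNReal.ofReal L) L' hL').trans_lt ENNReal.ofReal_lt_top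
  · refine ENNReal.div_le_of_le_mul' ?_
    refine (ENNReal.div_le_iff (ENNReal.ofReal_pos.2 hC₀).ne' ENNReal.ofReal_ne_top).1 ?_
    refine le_iInf₂ fun L' hL' => ENNReal.div_le_of_le_mul' ?_
    refine iSup₂_le fun L hL => ?_
    rw [← ENNReal.ofReal_mul hC₀.le]
    exact ENNReal.ofReal_le_ofReal (h L hL L' hL')

end Pores

theorem exists_poreRatio_le (hn : 1 ≤ n) {E : Set (EuclideanSpace ℝ (Fin n))} (hE : E.Nonempty)
    (hE0 : volume (closure E) = 0) {τ C s : ℝ} (hτ : 0 < τ) (hC : 0 < C) (hs : 0 < s) (hs1 : s < 1)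
    (h : ∀ Q : HalfOpenCube n, (∫⁻ x in Q.toSet, ENNReal.ofReal (Metric.infDist x E ^ τ)) *
      (∫⁻ x in Q.toSet, ENNReal.ofReal (Metric.infDist x E ^ (-τ))) ≤
        ENNReal.ofReal C * (volume Q.toSet * volume Q.toSet)) :
    ∃ C₀, 0 < C₀ ∧ ∀ Q : HalfOpenCube n, (Q.toSet ∩ closure E).Nonempty →
      0 < poreRatio s Q E ∧ poreRatio s Q E ≤ ENNReal.ofReal C₀ := by
  have hn' : (0 : ℝ) < n := by exact_mod_cast hn
  -- One factor s⁻¹ for each family of pores, and 2ⁿ for the central cubes.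
  set D : ℝ := C * (s⁻¹ * s⁻¹) * 2 ^ n with hD
  have hD0 : 0 < D := by positivity
  -- The factor 8n is 4 · 2n: a quarter of the side from below, 2n sides from above.
  refine ⟨8 * n * D ^ τ⁻¹, by positivity, fun Q hQ => poreRatio_pos_and_le (by positivity)
    (exists_mem_largePoreSet hQ hE0 hs1) ⟨_, side_mem_smallPoreSet hQ hE0 hs1.le⟩ ?_⟩
  intro L hL L' hL'
  have hL'0 := pos_of_mem_smallPoreSet hQ hs hL'
  obtain ⟨hL0, hL⟩ := (mem_largePoreSet_iff hQ).1 hL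
  obtain ⟨-, hL'⟩ := (mem_smallPoreSet_iff hQ).1 hL'
  set v := Q.side ^ n with hv
  have hv0 : 0 < v := pow_pos Q.side_pos n
  have h1 : ENNReal.ofReal ((1 / 2) ^ n * (1 / 4 * L) ^ τ) * (ENNReal.ofReal s * volume Q.toSet) ≤
      ∫⁻ x in Q.toSet, ENNReal.ofReal (Metric.infDist x E ^ τ) :=
    (mul_le_mul_right hL _).trans (mul_volume_poreUnion_le fun P hP hPL => by
      obtain ⟨_, _, _, _, hH, _⟩ := hP
      exact mul_volume_le_lintegral_infDist_rpow hE hH hτ.le hL0 hPL)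
  have h2 : ENNReal.ofReal ((2 * n * L') ^ (-τ)) * (ENNReal.ofReal s * volume Q.toSet) ≤
      ∫⁻ x in Q.toSet, ENNReal.ofReal (Metric.infDist x E ^ (-τ)) :=
    (mul_le_mul_right hL' _).trans (mul_volume_poreUnion_le fun P hP hPL =>
      mul_volume_le_lintegral_infDist_rpow_neg hE hQ hP hτ.le hPL)
  have h3 := (mul_le_mul' h1 h2).trans (h Q)
  rw [volume_toSet, ← hv, ← ENNReal.ofReal_mul hs.le, ← ENNReal.ofReal_mul (by positivity),
    ← ENNReal.ofReal_mul (by positivity), ← ENNReal.ofReal_mul (by positivity),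
    ← ENNReal.ofReal_mul (by positivity), ← ENNReal.ofReal_mul (by positivity),
    ENNReal.ofReal_le_ofReal_iff (by positivity)] at h3
  have h4 : (1 / 4 * L) ^ τ ≤ D * (2 * n * L') ^ τ := by
    rw [Real.rpow_neg (by positivity)] at h3
    have hy : 0 < (2 * n * L') ^ τ := by positivity
    generalize (2 * n * L') ^ τ = y at *
    generalize (1 / 4 * L) ^ τ = z at *
    have h5 : (1 / 2 : ℝ) ^ n * z * (s * v) * (y⁻¹ * (s * v)) =
        z * (2 ^ n)⁻¹ * y⁻¹ * (s * s) * (v * v) := by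
      rw [one_div, inv_pow]; ring
    rw [h5] at h3
    have h6 := le_of_mul_le_mul_right h3 (by positivity)
    calc z = z * (2 ^ n)⁻¹ * y⁻¹ * (s * s) * (2 ^ n * y * (s⁻¹ * s⁻¹)) := by field_simp
      _ ≤ C * (2 ^ n * y * (s⁻¹ * s⁻¹)) := by gcongr
      _ = D * y := by rw [hD]; ring
  have h7 : 1 / 4 * L ≤ D ^ τ⁻¹ * (2 * n * L') := by
    refine (Real.rpow_le_rpow_iff (by positivity) (by positivity) hτ).1 ?_
    rwa [Real.mul_rpow (x := D ^ τ⁻¹) (by positivity) (by positivity), ← Real.rpow_mul hD0.le,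
      inv_mul_cancel₀ hτ.ne', Real.rpow_one]
  linarith

end HalfOpenCube

/-! ### From the pore ratio to the Muckenhoupt condition -/

namespace HalfOpenCube

variable {n : ℕ} {E : Set (EuclideanSpace ℝ (Fin n))} {Q : HalfOpenCube n} {s : ℝ}

theorem volume_closure_inter_le_of_poreRatio_pos (hs : 0 < s) (hs1 : s < 1)
    (hQ : (Q.toSet ∩ closure E).Nonempty) (h : 0 < poreRatio s Q E) :
    volume (closure E ∩ Q.toSet) ≤ ENNReal.ofReal (1 - s) * volume Q.toSet := by
  obtain ⟨L, hL⟩ : (largePoreSet s Q E).Nonempty := by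
    by_contra hne
    rw [Set.not_nonempty_iff_eq_empty] at hne
    simp [poreRatio, hne] at h
  obtain ⟨-, hL⟩ := (mem_largePoreSet_iff hQ).1 hL
  set V := poreUnion E Q fun P => L ≤ P.side
  have hdisj : Disjoint (closure E ∩ Q.toSet) V :=
    Set.disjoint_left.2 fun x hx hxV => (poreUnion_subset _ hxV).2 hx.1
  have hsum : volume (closure E ∩ Q.toSet) + ENNReal.ofReal s * volume Q.toSet ≤
      ENNReal.ofReal (1 - s) * volume Q.toSet + ENNReal.ofReal s * volume Q.toSet := by
    rw [← add_mul, ← ENNReal.ofReal_add (by linarith) hs.le, sub_add_cancel, ENNReal.ofReal_one,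
      one_mul]
    calc _ ≤ volume (closure E ∩ Q.toSet) + volume V := by gcongr
      _ = volume (closure E ∩ Q.toSet ∪ V) :=
        (measure_union hdisj (measurableSet_poreUnion _)).symm
      _ ≤ _ := measure_mono (Set.union_subset Set.inter_subset_right
        ((poreUnion_subset _).trans Set.sdiff_subset))
  exact (ENNReal.add_le_add_iff_right
    (ENNReal.mul_ne_top ENNReal.ofReal_ne_top Q.volume_toSet_ne_top)).1 hsum

/-- Positivity of the quotient gives a nonzero numerator and a finite denominator. A zero
denominator would make it infinite, so the upper bound excludes that and makes the numerator finite.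
-/
theorem exists_bounds_of_poreRatio {C₀ : ℝ} (hC₀ : 0 < C₀) (h0 : 0 < poreRatio s Q E)
    (h : poreRatio s Q E ≤ ENNReal.ofReal C₀) :
    ∃ u l : ℝ, 0 < u ∧ 0 < l ∧ u ≤ C₀ * l ∧ (∀ L ∈ largePoreSet s Q E, L ≤ u) ∧
      ∀ L ∈ smallPoreSet s Q E, l ≤ L := by
  rw [poreRatio] at h0 h
  set U := ⨆ L ∈ largePoreSet s Q E, ENNReal.ofReal L with hU
  set I := ⨅ L ∈ smallPoreSet s Q E, ENNReal.ofReal L with hI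
  obtain ⟨hU0, hIt⟩ := ENNReal.div_pos_iff.1 h0
  have hI0 : I ≠ 0 := by
    intro hI0
    rw [hI0, ENNReal.div_zero hU0] at h
    exact absurd h (by simp)
  have hUI : U ≤ ENNReal.ofReal C₀ * I := (ENNReal.div_le_iff hI0 hIt).1 h
  have hUt : U ≠ ∞ := ne_top_of_le_ne_top (ENNReal.mul_ne_top ENNReal.ofReal_ne_top hIt) hUI
  refine ⟨U.toReal, I.toReal, ENNReal.toReal_pos hU0 hUt, ENNReal.toReal_pos hI0 hIt, ?_, ?_, ?_⟩
  · have := ENNReal.toReal_mono (ENNReal.mul_ne_top ENNReal.ofReal_ne_top hIt) hUI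
    rwa [ENNReal.toReal_mul, ENNReal.toReal_ofReal hC₀.le] at this
  · intro L hL
    exact (ENNReal.ofReal_le_iff_le_toReal hUt).1
      (le_iSup₂ (f := fun L _ => ENNReal.ofReal L) L hL)
  · intro L hL
    exact ENNReal.toReal_le_of_le_ofReal hL.1
      (iInf₂_le (f := fun L _ => ENNReal.ofReal L) L hL)

/-- Twice the supremum and half the infimum lie strictly outside the two sets of admissible L, so
the pores beyond them fill less than the fraction s. The two factors 2 account for the 4 in
log(4C₀). -/
theorem exists_median_bounds {C₀ : ℝ} (hC₀ : 0 < C₀) (hE0 : volume (closure E) = 0)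
    (hQ : (Q.toSet ∩ closure E).Nonempty)
    (h0 : 0 < poreRatio s Q E) (h : poreRatio s Q E ≤ ENNReal.ofReal C₀) :
    ∃ a b : ℝ, b ≤ a + Real.log (4 * C₀) ∧
      volume {x ∈ Q.toSet | b < Real.log (Q.poreSide E x)} ≤ ENNReal.ofReal s * volume Q.toSet ∧
      volume {x ∈ Q.toSet | Real.log (Q.poreSide E x) < a} ≤
        ENNReal.ofReal s * volume Q.toSet := by
  obtain ⟨u, l, hu, hl, hul, hlarge, hsmall⟩ := exists_bounds_of_poreRatio hC₀ h0 h
  refine ⟨Real.log (l / 2), Real.log (2 * u), ?_, ?_, ?_⟩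
  · rw [← Real.log_mul (by positivity) (by positivity)]
    exact Real.log_le_log (by positivity) (by linarith)
  · have hnot : 2 * u ∉ largePoreSet s Q E := fun hmem => by linarith [hlarge _ hmem]
    rw [mem_largePoreSet_iff hQ, not_and, not_le] at hnot
    refine le_trans ?_ (hnot (by positivity)).le
    rw [← measure_sdiff_null hE0]
    refine measure_mono ?_
    rintro x ⟨⟨hx, hlt⟩, hxE⟩
    obtain ⟨P, hP, hxP⟩ := exists_mem_pore hx hxE
    refine mem_poreUnion.2 ⟨P, hP, ?_, hxP⟩
    rw [poreSide_eq hP hxP] at hlt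
    exact ((Real.log_lt_log_iff (by positivity) P.side_pos).1 hlt).le
  · have hnot : l / 2 ∉ smallPoreSet s Q E := fun hmem => by linarith [hsmall _ hmem]
    rw [mem_smallPoreSet_iff hQ, not_and, not_le] at hnot
    refine le_trans ?_ (hnot (by positivity)).le
    rw [← measure_sdiff_null hE0]
    refine measure_mono ?_
    rintro x ⟨⟨hx, hlt⟩, hxE⟩
    obtain ⟨P, hP, hxP⟩ := exists_mem_pore hx hxE
    refine mem_poreUnion.2 ⟨P, hP, ?_, hxP⟩
    rw [poreSide_eq hP hxP] at hlt
    exact ((Real.log_lt_log_iff P.side_pos (by positivity)).1 hlt).le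

/-- If the logarithm of the pore side has uniformly bounded local oscillation, then its
distribution function decays exponentially. -/
theorem volume_log_poreSide_le {σ K : ℝ} (hK : 0 ≤ K) (hs : 0 ≤ s) (hσ : 0 < σ) (hsσ : s ≤ σ)
    (hσn : 2 ^ n * σ + s < 1) (hE0 : volume (closure E) = 0) {a b : HalfOpenCube n → ℝ}
    (hab : ∀ Q : HalfOpenCube n, (Q.toSet ∩ closure E).Nonempty → b Q ≤ a Q + K)
    (hb : ∀ Q : HalfOpenCube n, (Q.toSet ∩ closure E).Nonempty →
      volume {x ∈ Q.toSet | b Q < Real.log (Q.poreSide E x)} ≤ ENNReal.ofReal s * volume Q.toSet)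
    (ha : ∀ Q : HalfOpenCube n, (Q.toSet ∩ closure E).Nonempty →
      volume {x ∈ Q.toSet | Real.log (Q.poreSide E x) < a Q} ≤ ENNReal.ofReal s * volume Q.toSet)
    (hQ : (Q.toSet ∩ closure E).Nonempty) (k : ℕ) :
    volume {x ∈ Q.toSet | b Q + k * K < Real.log (Q.poreSide E x)} ≤
        ENNReal.ofReal ((s / σ) ^ k) * volume Q.toSet ∧
      volume {x ∈ Q.toSet | -a Q + k * K < -Real.log (Q.poreSide E x)} ≤
        ENNReal.ofReal ((s / σ) ^ k) * volume Q.toSet := by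
  classical
  set f : EuclideanSpace ℝ (Fin n) → ℝ := fun x => Real.log (Q.poreSide E x) with hf
  -- On cubes missing `closure E` the function f is constant; its value serves as both bounds, with
  -- empty exceptional sets.
  set a' : HalfOpenCube n → ℝ := fun P => if P.Misses E then f P.corner else a P with ha'
  set b' : HalfOpenCube n → ℝ := fun P => if P.Misses E then f P.corner else b P with hb'
  have hconst : ∀ P ∈ Q.dyadic, P.Misses E → ∀ x ∈ P.toSet, f x = f P.corner := by
    intro P hP hPE x hx
    simp only [hf]
    rw [poreSide_eq_of_misses hP hPE (x := P.corner)
      (fun i => ⟨le_rfl, by linarith [P.side_pos]⟩) hx]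
  have hab' : ∀ P ∈ Q.dyadic, b' P ≤ a' P + K := by
    intro P _
    by_cases hPE : P.Misses E
    · simp [ha', hb', hPE, hK]
    · simpa [ha', hb', hPE] using hab P (not_misses.1 hPE)
  have hbP : ∀ P ∈ Q.dyadic,
      volume {x ∈ P.toSet | b' P < f x} ≤ ENNReal.ofReal s * volume P.toSet := by
    intro P hP
    by_cases hPE : P.Misses E
    · have : {x ∈ P.toSet | b' P < f x} = ∅ := by
        refine Set.eq_empty_of_forall_notMem fun x ⟨hx, hlt⟩ => ?_
        simp [hb', hPE, hconst P hP hPE x hx] at hlt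
      simp [this]
    · refine le_trans ?_ (hb P (not_misses.1 hPE))
      -- At points of `closure E` in P the pore side relative to P takes the default value `P.side`,
      -- which depends on P; the null set is discarded before comparing with Q.
      rw [← measure_sdiff_null hE0]
      refine measure_mono ?_
      rintro x ⟨⟨hx, hlt⟩, hxE⟩
      refine ⟨hx, ?_⟩
      rw [poreSide_of_mem_dyadic hP (not_misses.1 hPE) hx hxE]
      simpa [hb', hPE] using hlt
  have haP : ∀ P ∈ Q.dyadic,
      volume {x ∈ P.toSet | f x < a' P} ≤ ENNReal.ofReal s * volume P.toSet := by
    intro P hP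
    by_cases hPE : P.Misses E
    · have : {x ∈ P.toSet | f x < a' P} = ∅ := by
        refine Set.eq_empty_of_forall_notMem fun x ⟨hx, hlt⟩ => ?_
        simp [ha', hPE, hconst P hP hPE x hx] at hlt
      simp [this]
    · refine le_trans ?_ (ha P (not_misses.1 hPE))
      rw [← measure_sdiff_null hE0]
      refine measure_mono ?_
      rintro x ⟨⟨hx, hlt⟩, hxE⟩
      refine ⟨hx, ?_⟩
      rw [poreSide_of_mem_dyadic hP (not_misses.1 hPE) hx hxE]
      simpa [ha', hPE] using hlt
  have hae : ∀ᵐ x, x ∈ Q.toSet → ∃ j, ∀ y ∈ (Q.cellAt j x).toSet, f y = f x := by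
    filter_upwards [measure_eq_zero_iff_ae_notMem.1 hE0] with x hxE hx
    obtain ⟨j, hj⟩ := exists_cellAt_misses hx hxE
    refine ⟨j, fun y hy => ?_⟩
    have hd := cellAt_mem_dyadic hx j
    rw [hconst _ hd hj y hy, hconst _ hd hj x (mem_cellAt hx)]
  have hQm : ¬Q.Misses E := not_misses.2 hQ
  constructor
  · have := volume_superlevel_le hK hs hσ hsσ hσn hab' hbP haP hae k Q Q.self_mem_dyadic
    simpa [hb', hQm] using this
  · have := volume_superlevel_le (f := fun x => -f x) (a := fun P => -b' P) (b := fun P => -a' P)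
      hK hs hσ hsσ hσn (fun P hP => by linarith [hab' P hP])
      (fun P hP => by simpa only [neg_lt_neg_iff] using haP P hP)
      (fun P hP => by simpa only [neg_lt_neg_iff] using hbP P hP)
      (by simpa only [neg_inj] using hae) k Q Q.self_mem_dyadic
    simpa [ha', hQm] using this

/-- Negative powers of the distance function are integrable on cubes missing the set. -/
theorem lintegral_infDist_rpow_neg_le (hE : E.Nonempty) (hQ : Q.Misses E) {β : ℝ} (hβ : 0 ≤ β)
    (hβ1 : Real.exp (β * Real.log 2) * (1 / 2) < 1) :
    ∫⁻ x in Q.toSet, ENNReal.ofReal (Metric.infDist x E ^ (-β)) ≤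
      ENNReal.ofReal (Q.side ^ (-β)) *
        (ENNReal.ofReal (1 + Real.exp (β * Real.log 2) /
          (1 - Real.exp (β * Real.log 2) * (1 / 2))) *
          (ENNReal.ofReal (2 * n + 2) * volume Q.toSet)) := by
  have hpos : ∀ x ∈ Q.toSet, 0 < Metric.infDist x E := fun x hx =>
    infDist_pos_of_notMem hE fun hxE => Set.eq_empty_iff_forall_notMem.1 hQ x ⟨hx, hxE⟩
  have hside : Q.side ^ (-β) = Real.exp (β * -Real.log Q.side) := by
    rw [Real.rpow_def_of_pos Q.side_pos]; ring_nf
  rw [hside]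
  refine (setLIntegral_mono' Q.measurableSet_toSet fun x hx => le_of_eq
    (congrArg ENNReal.ofReal (show _ = Real.exp (β * -Real.log (Metric.infDist x E)) by
      rw [Real.rpow_def_of_pos (hpos x hx)]; ring_nf))).trans ?_
  refine lintegral_exp_le_of_decay (Real.log_pos one_lt_two) hβ (by norm_num) hβ1
    (fun k => ?_) ?_
  · rw [Measure.restrict_apply' Q.measurableSet_toSet]
    set t : ℝ := (1 / 2) ^ k with ht
    have ht0 : 0 < t := by positivity
    rw [← mul_assoc, ← ENNReal.ofReal_mul ht0.le]
    rcases lt_or_ge t (1 / 2) with ht2 | ht2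
    · have hsub : {x | -Real.log Q.side + k * Real.log 2 < -Real.log (Metric.infDist x E)} ∩
          Q.toSet ⊆ Q.toSet \ (Q.inner t ht2).toSet := by
        rintro x ⟨hx, hxQ⟩
        refine ⟨hxQ, fun hxi => ?_⟩
        have h1 := Real.log_le_log (mul_pos ht0 Q.side_pos) (le_infDist_of_mem_inner hE hQ ht2 hxi)
        have h2 : Real.log t = -(k * Real.log 2) := by
          rw [ht, Real.log_pow, one_div, Real.log_inv]; ring
        rw [Real.log_mul ht0.ne' Q.side_pos.ne', h2] at h1
        have h3 : -Real.log Q.side + k * Real.log 2 < -Real.log (Metric.infDist x E) := hx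
        linarith
      refine (measure_mono hsub).trans ?_
      -- Bernoulli: the boundary shell of relative width t has relative volume at most 2nt. The
      -- extra 2 in 2n + 2 covers t ≥ 1/2, where there is no inner cube.
      have hb := one_add_mul_le_pow (show (-2 : ℝ) ≤ -(2 * t) by linarith) n
      rw [measure_sdiff (inner_subset ht0.le ht2) (measurableSet_toSet _).nullMeasurableSet
        (volume_toSet_ne_top _), volume_inner, tsub_le_iff_right, ← add_mul,
        ← ENNReal.ofReal_add (by positivity) (pow_nonneg (by linarith) _)]
      refine le_mul_of_one_le_left' ?_
      rw [← ENNReal.ofReal_one]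
      refine ENNReal.ofReal_le_ofReal ?_
      rw [← sub_eq_add_neg] at hb
      nlinarith
    · refine (measure_mono Set.inter_subset_right).trans (le_mul_of_one_le_left' ?_)
      rw [← ENNReal.ofReal_one]
      refine ENNReal.ofReal_le_ofReal ?_
      have : (0 : ℝ) ≤ n := n.cast_nonneg
      nlinarith
  · rw [Measure.restrict_apply_univ]
    refine le_mul_of_one_le_left' ?_
    rw [← ENNReal.ofReal_one]
    refine ENNReal.ofReal_le_ofReal ?_
    have : (0 : ℝ) ≤ n := n.cast_nonneg
    linarith

/-- The distance has no pointwise lower bound by the pore side, so the comparison is made after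
integrating over each pore. -/
theorem lintegral_infDist_rpow_neg_le_poreSide (hE0 : volume (closure E) = 0)
    {β : ℝ} {c : ℝ≥0∞}
    (h : ∀ P : HalfOpenCube n, P.Misses E →
      ∫⁻ x in P.toSet, ENNReal.ofReal (Metric.infDist x E ^ (-β)) ≤
        c * (ENNReal.ofReal (P.side ^ (-β)) * volume P.toSet)) :
    ∫⁻ x in Q.toSet, ENNReal.ofReal (Metric.infDist x E ^ (-β)) ≤
      c * ∫⁻ x in Q.toSet, ENNReal.ofReal (Q.poreSide E x ^ (-β)) := by
  have hS : (Q.stopping (Misses E)).Countable := countable_stopping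
  have hU : ∫⁻ x in Q.toSet, ENNReal.ofReal (Metric.infDist x E ^ (-β)) ≤
      ∫⁻ x in ⋃ P ∈ Q.stopping (Misses E), P.toSet,
        ENNReal.ofReal (Metric.infDist x E ^ (-β)) := by
    refine lintegral_mono_set' ?_
    filter_upwards [measure_eq_zero_iff_ae_notMem.1 hE0] with x hxE hx
    obtain ⟨P, hP, hxP⟩ := exists_mem_pore hx hxE
    exact Set.mem_biUnion hP hxP
  refine hU.trans ?_
  have hd := pairwiseDisjoint_stopping (Q := Q) (H := Misses E)
  rw [lintegral_biUnion hS (fun P _ => P.measurableSet_toSet) hd]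
  calc _ ≤ ∑' P : Q.stopping (Misses E),
        c * ∫⁻ x in P.1.toSet, ENNReal.ofReal (Q.poreSide E x ^ (-β)) := by
        refine ENNReal.tsum_le_tsum fun P => ?_
        have hP : P.1.Misses E := by obtain ⟨_, _, _, _, _, hH, _⟩ := P; exact hH
        refine (h P.1 hP).trans_eq ?_
        rw [← setLIntegral_const]
        congr 1
        exact setLIntegral_congr_fun P.1.measurableSet_toSet fun x hx => by
          simp only [poreSide_eq P.2 hx]
    _ = c * ∫⁻ x in ⋃ P ∈ Q.stopping (Misses E), P.toSet,
          ENNReal.ofReal (Q.poreSide E x ^ (-β)) := by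
        rw [ENNReal.tsum_mul_left, lintegral_biUnion hS (fun P _ => P.measurableSet_toSet) hd]
    _ ≤ _ := by
        gcongr
        exact Set.iUnion₂_subset fun P hP => subset_of_mem_dyadic (stopping_subset_dyadic hP)

theorem lintegral_infDist_rpow_le_poreSide (hE0 : volume (closure E) = 0)
    (hQ : (Q.toSet ∩ closure E).Nonempty) {θ : ℝ} (hθ : 0 ≤ θ) :
    ∫⁻ x in Q.toSet, ENNReal.ofReal (Metric.infDist x E ^ θ) ≤
      ENNReal.ofReal ((2 * n) ^ θ) * ∫⁻ x in Q.toSet, ENNReal.ofReal (Q.poreSide E x ^ θ) := by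
  rw [← lintegral_const_mul' _ _ ENNReal.ofReal_ne_top]
  refine lintegral_mono_ae ?_
  filter_upwards [ae_restrict_of_ae (measure_eq_zero_iff_ae_notMem.1 hE0),
    ae_restrict_mem Q.measurableSet_toSet] with x hxE hx
  obtain ⟨P, hP, hxP⟩ := exists_mem_pore hx hxE
  rw [← ENNReal.ofReal_mul (by positivity), ← Real.mul_rpow (by positivity) poreSide_pos.le,
    poreSide_eq hP hxP]
  refine ENNReal.ofReal_le_ofReal (Real.rpow_le_rpow Metric.infDist_nonneg ?_ hθ)
  exact infDist_le_of_mem_pore hQ hP hxP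

/-- Two-sided control of the means of powers of the distance function over cubes that meet
the closure of the set. -/
theorem exists_mean_bounds_of_meets {K q : ℝ} (hE : E.Nonempty) (hE0 : volume (closure E) = 0)
    (hK : 0 < K) (hq : 0 ≤ q) {a b : HalfOpenCube n → ℝ}
    (hab : ∀ Q : HalfOpenCube n, (Q.toSet ∩ closure E).Nonempty → b Q ≤ a Q + K)
    (hdecay : ∀ Q : HalfOpenCube n, (Q.toSet ∩ closure E).Nonempty → ∀ k : ℕ,
      volume {x ∈ Q.toSet | b Q + k * K < Real.log (Q.poreSide E x)} ≤
        ENNReal.ofReal (q ^ k) * volume Q.toSet ∧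
      volume {x ∈ Q.toSet | -a Q + k * K < -Real.log (Q.poreSide E x)} ≤
        ENNReal.ofReal (q ^ k) * volume Q.toSet)
    {θ β : ℝ} (hθ : 0 ≤ θ) (hβ : 0 ≤ β) (hθq : Real.exp (θ * K) * q < 1)
    (hβq : Real.exp (β * K) * q < 1) (hβ1 : Real.exp (β * Real.log 2) * (1 / 2) < 1) :
    ∃ M : ℝ, 0 < M ∧ ∀ Q : HalfOpenCube n, (Q.toSet ∩ closure E).Nonempty → ∃ m : ℝ, 0 < m ∧
      ∫⁻ x in Q.toSet, ENNReal.ofReal (Metric.infDist x E ^ θ) ≤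
        ENNReal.ofReal (M * m ^ θ) * volume Q.toSet ∧
      ∫⁻ x in Q.toSet, ENNReal.ofReal (Metric.infDist x E ^ (-β)) ≤
        ENNReal.ofReal (M * m ^ (-β)) * volume Q.toSet := by
  have hpos : ∀ {τ : ℝ} {r t : ℝ}, Real.exp (τ * r) * t < 1 →
      0 < 1 + Real.exp (τ * r) / (1 - Real.exp (τ * r) * t) := fun h => by
    have := Real.exp_pos
    have := sub_pos.2 h
    positivity
  set cθ := 1 + Real.exp (θ * K) / (1 - Real.exp (θ * K) * q) with hcθ
  set cβ := 1 + Real.exp (β * K) / (1 - Real.exp (β * K) * q) with hcβ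
  set d := 1 + Real.exp (β * Real.log 2) / (1 - Real.exp (β * Real.log 2) * (1 / 2)) with hd
  have hcθ0 : 0 < cθ := hpos hθq
  have hcβ0 : 0 < cβ := hpos hβq
  have hd0 : 0 < d := hpos hβ1
  set M₁ := (2 * n) ^ θ * (Real.exp (θ * K) * cθ) with hM₁
  set M₂ := d * (2 * n + 2) * cβ with hM₂
  have hM₁0 : 0 ≤ M₁ := by positivity
  have hM₂0 : 0 < M₂ := by positivity
  -- The scale exp(a(Q)) serves both powers, since b(Q) exceeds a(Q) by at most K.
  refine ⟨M₁ + M₂, by positivity, fun Q hQ => ⟨Real.exp (a Q), Real.exp_pos _, ?_, ?_⟩⟩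
  · have h1 := lintegral_exp_le_of_decay (μ := volume.restrict Q.toSet)
      (g := fun x => Real.log (Q.poreSide E x)) (b := b Q) (M := volume Q.toSet) hK hθ hq hθq
      (fun k => by
        rw [Measure.restrict_apply' Q.measurableSet_toSet, Set.inter_comm]
        exact (hdecay Q hQ k).1)
      (Measure.restrict_apply_univ _).le
    have h2 : ∀ x, Real.exp (θ * Real.log (Q.poreSide E x)) = Q.poreSide E x ^ θ := fun x => by
      rw [Real.rpow_def_of_pos poreSide_pos, mul_comm]
    simp only [h2] at h1
    refine (lintegral_infDist_rpow_le_poreSide hE0 hQ hθ).trans ?_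
    refine (mul_le_mul_right h1 _).trans ?_
    rw [← mul_assoc, ← mul_assoc, ← ENNReal.ofReal_mul (by positivity),
      ← ENNReal.ofReal_mul (by positivity)]
    refine mul_le_mul_left (ENNReal.ofReal_le_ofReal ?_) _
    rw [← Real.exp_mul]
    calc (2 * (n : ℝ)) ^ θ * Real.exp (θ * b Q) * cθ
        ≤ (2 * n) ^ θ * Real.exp (θ * (a Q + K)) * cθ := by
          gcongr
          exact hab Q hQ
      _ = M₁ * Real.exp (a Q * θ) := by
          rw [hM₁, mul_add θ, Real.exp_add, mul_comm (a Q) θ]; ring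
      _ ≤ _ := by gcongr; linarith
  · have h1 := lintegral_exp_le_of_decay (μ := volume.restrict Q.toSet)
      (g := fun x => -Real.log (Q.poreSide E x)) (b := -a Q) (M := volume Q.toSet) hK hβ hq hβq
      (fun k => by
        rw [Measure.restrict_apply' Q.measurableSet_toSet, Set.inter_comm]
        exact (hdecay Q hQ k).2)
      (Measure.restrict_apply_univ _).le
    have h2 : ∀ x, Real.exp (β * -Real.log (Q.poreSide E x)) = Q.poreSide E x ^ (-β) := fun x => by
      rw [Real.rpow_def_of_pos poreSide_pos]; ring_nf
    simp only [h2] at h1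
    refine (lintegral_infDist_rpow_neg_le_poreSide hE0
      (c := ENNReal.ofReal (d * (2 * n + 2))) fun P hP => ?_).trans ?_
    · refine (lintegral_infDist_rpow_neg_le hE hP hβ hβ1).trans_eq ?_
      rw [ENNReal.ofReal_mul hd0.le]
      ring
    · refine (mul_le_mul_right h1 _).trans ?_
      rw [← mul_assoc, ← mul_assoc, ← ENNReal.ofReal_mul (by positivity),
        ← ENNReal.ofReal_mul (by positivity)]
      refine mul_le_mul_left (ENNReal.ofReal_le_ofReal ?_) _
      rw [← Real.exp_mul]
      calc d * (2 * n + 2) * Real.exp (β * -a Q) * cβ = M₂ * Real.exp (a Q * -β) := by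
            rw [hM₂, show β * -a Q = a Q * -β by ring]; ring
        _ ≤ _ := by gcongr; linarith

/-- A cube close to E is enlarged by a fixed factor until it meets `closure E`; on a cube far from E
the distance is comparable to a constant. -/
theorem exists_mean_bounds (hE : E.Nonempty) {θ β M : ℝ} (hθ : 0 ≤ θ) (hβ : 0 ≤ β) (hM : 0 < M)
    (h : ∀ Q : HalfOpenCube n, (Q.toSet ∩ closure E).Nonempty → ∃ m : ℝ, 0 < m ∧
      ∫⁻ x in Q.toSet, ENNReal.ofReal (Metric.infDist x E ^ θ) ≤
        ENNReal.ofReal (M * m ^ θ) * volume Q.toSet ∧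
      ∫⁻ x in Q.toSet, ENNReal.ofReal (Metric.infDist x E ^ (-β)) ≤
        ENNReal.ofReal (M * m ^ (-β)) * volume Q.toSet) :
    ∃ M' : ℝ, 0 < M' ∧ ∀ Q : HalfOpenCube n, ∃ m : ℝ, 0 < m ∧
      ∫⁻ x in Q.toSet, ENNReal.ofReal (Metric.infDist x E ^ θ) ≤
        ENNReal.ofReal (M' * m ^ θ) * volume Q.toSet ∧
      ∫⁻ x in Q.toSet, ENNReal.ofReal (Metric.infDist x E ^ (-β)) ≤
        ENNReal.ofReal (M' * m ^ (-β)) * volume Q.toSet := by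
  -- With r ≥ 2n the distance varies over a far cube by at most half its value at the corner. Side R
  -- = 2r + 1 lets the enlarged cube extend r sides beyond `Q` in each direction.
  set r : ℝ := 2 * n + 1 with hr
  set R : ℝ := 2 * r + 1 with hR
  have hn0 : (0 : ℝ) ≤ n := n.cast_nonneg
  have hr1 : 1 ≤ r := by linarith
  have hR0 : 0 < R := by linarith
  refine ⟨R ^ n * M + 2 ^ θ + 2 ^ β, by positivity, fun Q => ?_⟩
  have hl := Q.side_pos
  rcases lt_or_ge (Metric.infDist Q.corner E) (r * Q.side) with hlt | hge
  · obtain ⟨y, hyE, hy⟩ := (Metric.infDist_lt_iff hE).1 hlt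
    let P : HalfOpenCube n :=
      ⟨WithLp.toLp 2 fun i => Q.corner i - r * Q.side, R * Q.side, by positivity⟩
    have hQP : Q.toSet ⊆ P.toSet := by
      intro x hx i
      have := hx i
      simp only [P]
      constructor <;> nlinarith
    have hyP : y ∈ P.toSet := by
      intro i
      have h1 : |Q.corner i - y i| < r * Q.side := by
        have := (PiLp.norm_apply_le (Q.corner - y) i).trans_lt (by rwa [← dist_eq_norm])
        simpa using this
      rw [abs_lt] at h1
      simp only [P]
      constructor <;> nlinarith
    obtain ⟨m, hm, h1, h2⟩ := h P ⟨y, hyP, subset_closure hyE⟩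
    have hvol : volume P.toSet = ENNReal.ofReal (R ^ n) * volume Q.toSet := by
      rw [volume_toSet, volume_toSet, ← ENNReal.ofReal_mul (by positivity), ← mul_pow]
    have hle : R ^ n * M ≤ R ^ n * M + 2 ^ θ + 2 ^ β := by
      have : (0 : ℝ) ≤ 2 ^ θ := by positivity
      have : (0 : ℝ) ≤ 2 ^ β := by positivity
      linarith
    refine ⟨m, hm, (lintegral_mono_set hQP).trans (h1.trans ?_),
      (lintegral_mono_set hQP).trans (h2.trans ?_)⟩
    all_goals
      rw [hvol, ← mul_assoc, ← ENNReal.ofReal_mul (by positivity), mul_right_comm, mul_comm M]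
      gcongr
  · set D := Metric.infDist Q.corner E with hD
    have hD0 : 0 < D := lt_of_lt_of_le (by positivity) hge
    have hcorner : Q.corner ∈ Q.toSet := fun i => ⟨le_rfl, by linarith⟩
    have hclose : ∀ x ∈ Q.toSet, D / 2 ≤ Metric.infDist x E ∧ Metric.infDist x E ≤ 2 * D := by
      intro x hx
      have h1 := dist_le_of_mem hx hcorner
      have h2 : Metric.infDist x E ≤ D + dist x Q.corner := Metric.infDist_le_infDist_add_dist
      have h3 : D ≤ Metric.infDist x E + dist Q.corner x := Metric.infDist_le_infDist_add_dist
      rw [dist_comm] at h3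
      constructor <;> nlinarith
    have hRM : 0 ≤ R ^ n * M := by positivity
    have h2θ : (0 : ℝ) ≤ 2 ^ θ := by positivity
    have h2β : (0 : ℝ) ≤ 2 ^ β := by positivity
    refine ⟨D, hD0, ?_, ?_⟩
    · rw [← setLIntegral_const]
      refine setLIntegral_mono' Q.measurableSet_toSet fun x hx => ENNReal.ofReal_le_ofReal ?_
      calc Metric.infDist x E ^ θ ≤ (2 * D) ^ θ :=
            Real.rpow_le_rpow Metric.infDist_nonneg (hclose x hx).2 hθ
        _ = 2 ^ θ * D ^ θ := Real.mul_rpow zero_le_two hD0.le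
        _ ≤ _ := by gcongr; linarith
    · rw [← setLIntegral_const]
      refine setLIntegral_mono' Q.measurableSet_toSet fun x hx => ENNReal.ofReal_le_ofReal ?_
      calc Metric.infDist x E ^ (-β) ≤ (D / 2) ^ (-β) :=
            Real.rpow_le_rpow_of_nonpos (by positivity) (hclose x hx).1 (by linarith)
        _ = 2 ^ β * D ^ (-β) := by
            rw [Real.div_rpow hD0.le zero_le_two, Real.rpow_neg zero_le_two, div_inv_eq_mul,
              mul_comm]
        _ ≤ _ := by gcongr; linarith

/-- By continuity at θ = 0, where the conditions become q < 1 and 1/2 < 1. -/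
theorem exists_exp_mul_lt_one {p K q : ℝ} (hq : q < 1) :
    ∃ θ : ℝ, 0 < θ ∧ Real.exp (θ * K) * q < 1 ∧ Real.exp (θ / (p - 1) * K) * q < 1 ∧
      Real.exp (θ / (p - 1) * Real.log 2) * (1 / 2) < 1 := by
  have key : ∀ c r : ℝ, r < 1 → ∀ᶠ θ in nhdsWithin (0 : ℝ) (Set.Ioi 0),
      Real.exp (θ * c) * r < 1 := by
    intro c r hr
    have hcont : Continuous fun θ : ℝ => Real.exp (θ * c) * r := by fun_prop
    have := hcont.tendsto 0
    simp only [zero_mul, Real.exp_zero, one_mul] at this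
    exact (this.eventually_lt_const hr).filter_mono nhdsWithin_le_nhds
  obtain ⟨θ, ⟨⟨h1, h2⟩, h3⟩, h4⟩ := (((key K q hq).and (key (K / (p - 1)) q hq)).and
    (key (Real.log 2 / (p - 1)) (1 / 2) (by norm_num))).and self_mem_nhdsWithin |>.exists
  refine ⟨θ, h4, h1, ?_, ?_⟩
  · rwa [div_mul_eq_mul_div, mul_div_assoc]
  · rwa [div_mul_eq_mul_div, mul_div_assoc]

/-- The scale m cancels in the product of the two means. -/
theorem memMuckenhoupt_infDist_rpow {p θ M : ℝ} (hE : E.Nonempty) (hE0 : volume (closure E) = 0)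
    (hp : 1 < p) (hθ : 0 < θ) (hM : 0 < M)
    (h : ∀ Q : HalfOpenCube n, ∃ m : ℝ, 0 < m ∧
      ∫⁻ x in Q.toSet, ENNReal.ofReal (Metric.infDist x E ^ θ) ≤
        ENNReal.ofReal (M * m ^ θ) * volume Q.toSet ∧
      ∫⁻ x in Q.toSet, ENNReal.ofReal (Metric.infDist x E ^ (-(θ / (p - 1)))) ≤
        ENNReal.ofReal (M * m ^ (-(θ / (p - 1)))) * volume Q.toSet) :
    MemMuckenhoupt p fun x => Metric.infDist x E ^ θ := by
  have hp1 : 0 < p - 1 := sub_pos.2 hp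
  refine ⟨⟨?_, ?_⟩, M * M ^ (p - 1), by positivity, fun Q => ?_⟩
  · exact ((Metric.continuous_infDist_pt E).rpow_const fun _ => Or.inr hθ.le).locallyIntegrable
  · filter_upwards [measure_eq_zero_iff_ae_notMem.1 hE0] with x hx
    exact Real.rpow_pos_of_pos (infDist_pos_of_notMem hE hx) _
  · obtain ⟨m, hm, h1, h2⟩ := h Q
    have hpow : ∀ x, (Metric.infDist x E ^ θ) ^ (-(1 / (p - 1))) =
        Metric.infDist x E ^ (-(θ / (p - 1))) := fun x => by
      rw [← Real.rpow_mul Metric.infDist_nonneg]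
      congr 1
      ring
    simp only [hpow, setLAverage_eq]
    calc _ ≤ ENNReal.ofReal (M * m ^ θ) *
          ENNReal.ofReal (M * m ^ (-(θ / (p - 1)))) ^ (p - 1) := by
          gcongr
          · exact ENNReal.div_le_of_le_mul h1
          · exact ENNReal.div_le_of_le_mul h2
      _ = ENNReal.ofReal (M * M ^ (p - 1)) := by
          rw [ENNReal.ofReal_rpow_of_nonneg (by positivity) hp1.le,
            ← ENNReal.ofReal_mul (by positivity), Real.mul_rpow hM.le (by positivity),
            ← Real.rpow_mul hm.le, neg_mul, div_mul_cancel₀ _ hp1.ne', Real.rpow_neg hm.le]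
          congr 1
          have : m ^ θ ≠ 0 := (Real.rpow_pos_of_pos hm θ).ne'
          field_simp
      _ ≤ _ := le_rfl

/-! ### Consequences of the Muckenhoupt condition -/

/-- On `closure E` the function is `0 ^ θ = 0`, by convention also for θ < 0, while a weight is
positive almost everywhere. -/
theorem volume_closure_eq_zero_of_isWeight {θ : ℝ} (hθ : θ ≠ 0)
    (h : IsWeight fun x => Metric.infDist x E ^ θ) : volume (closure E) = 0 := by
  rw [measure_eq_zero_iff_ae_notMem]
  filter_upwards [h.2] with x hx hxE
  rw [← Metric.infDist_closure, Metric.infDist_zero_of_mem hxE, Real.zero_rpow hθ] at hx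
  exact lt_irrefl _ hx

/-- For p = 2 the condition is symmetric in θ and -θ, so τ = |θ| works. -/
theorem exists_lintegral_mul_le_of_memMuckenhoupt_two {θ : ℝ} (hθ : θ ≠ 0)
    (h : MemMuckenhoupt 2 fun x => Metric.infDist x E ^ θ) :
    ∃ τ C : ℝ, 0 < τ ∧ 0 < C ∧ ∀ Q : HalfOpenCube n,
      (∫⁻ x in Q.toSet, ENNReal.ofReal (Metric.infDist x E ^ τ)) *
        (∫⁻ x in Q.toSet, ENNReal.ofReal (Metric.infDist x E ^ (-τ))) ≤
          ENNReal.ofReal C * (volume Q.toSet * volume Q.toSet) := by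
  obtain ⟨-, C, hC, hA⟩ := h
  have key : ∀ Q : HalfOpenCube n,
      (∫⁻ x in Q.toSet, ENNReal.ofReal (Metric.infDist x E ^ θ)) *
        (∫⁻ x in Q.toSet, ENNReal.ofReal (Metric.infDist x E ^ (-θ))) ≤
          ENNReal.ofReal C * (volume Q.toSet * volume Q.toSet) := by
    intro Q
    have hpow : ∀ x, (Metric.infDist x E ^ θ) ^ (-(1 / ((2 : ℝ) - 1))) =
        Metric.infDist x E ^ (-θ) := fun x => by
      rw [← Real.rpow_mul Metric.infDist_nonneg]
      congr 1
      norm_num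
    have hQ := hA Q
    simp only [hpow, setLAverage_eq] at hQ
    rw [show (2 : ℝ) - 1 = 1 by norm_num, ENNReal.rpow_one] at hQ
    have h0 := Q.volume_toSet_ne_zero
    have ht := Q.volume_toSet_ne_top
    calc _ = (∫⁻ x in Q.toSet, ENNReal.ofReal (Metric.infDist x E ^ θ)) / volume Q.toSet *
          volume Q.toSet * ((∫⁻ x in Q.toSet, ENNReal.ofReal (Metric.infDist x E ^ (-θ))) /
            volume Q.toSet * volume Q.toSet) := by
          rw [ENNReal.div_mul_cancel h0 ht, ENNReal.div_mul_cancel h0 ht]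
      _ = _ := mul_mul_mul_comm _ _ _ _
      _ ≤ _ := by gcongr
  rcases lt_or_gt_of_ne hθ with h | h
  · refine ⟨-θ, C, by linarith, hC, fun Q => ?_⟩
    rw [neg_neg, mul_comm]
    exact key Q
  · exact ⟨θ, C, h, hC, key⟩

theorem exists_memMuckenhoupt_of_poreRatio (hE : E.Nonempty) {C₀ : ℝ} (hC₀ : 0 < C₀) (hs : 0 < s)
    (hsn : s < (1 + 2 ^ n)⁻¹)
    (h : ∀ Q : HalfOpenCube n, (Q.toSet ∩ closure E).Nonempty →
      0 < poreRatio s Q E ∧ poreRatio s Q E ≤ ENNReal.ofReal C₀) {p : ℝ} (hp : 1 < p) :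
    ∃ θ : ℝ, θ ≠ 0 ∧ MemMuckenhoupt p fun x => Metric.infDist x E ^ θ := by
  classical
  have h2n : (1 : ℝ) ≤ 2 ^ n := one_le_pow₀ one_le_two
  have hsn' : s * (1 + 2 ^ n) < 1 := by
    rwa [← one_div, lt_div_iff₀ (by positivity)] at hsn
  have hs1 : s < 1 := by nlinarith
  have hE0 : volume (closure E) = 0 := by
    refine volume_eq_zero_of_forall (volume_closure_inter_eq_zero
      (c := ENNReal.ofReal (1 - s)) (ENNReal.ofReal_lt_one.2 (by linarith)) fun Q hQ => ?_)
    exact volume_closure_inter_le_of_poreRatio_pos hs hs1 hQ (h Q hQ).1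
  -- The only place where the threshold (1+2ⁿ)⁻¹ is essential: it makes this interval nonempty.
  obtain ⟨σ, hσ1, hσ2⟩ : ∃ σ, s < σ ∧ σ < (1 - s) / 2 ^ n := by
    refine exists_between ?_
    rw [lt_div_iff₀ (by positivity)]
    linarith
  rw [lt_div_iff₀ (by positivity)] at hσ2
  have hσ0 : 0 < σ := hs.trans hσ1
  choose! a b hab hb ha using fun (Q : HalfOpenCube n) (hQ : (Q.toSet ∩ closure E).Nonempty) =>
    exists_median_bounds hC₀ hE0 hQ (h Q hQ).1 (h Q hQ).2
  set K := max (Real.log (4 * C₀)) 1 with hK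
  have hK0 : 0 < K := lt_of_lt_of_le one_pos (le_max_right _ _)
  have habK : ∀ Q : HalfOpenCube n, (Q.toSet ∩ closure E).Nonempty → b Q ≤ a Q + K := fun Q hQ =>
    (hab Q hQ).trans (by gcongr; exact le_max_left _ _)
  obtain ⟨θ, hθ, hθK, hβK, hβ2⟩ :=
    exists_exp_mul_lt_one (p := p) (K := K) (q := s / σ) ((div_lt_one hσ0).2 hσ1)
  have hβ : 0 ≤ θ / (p - 1) := div_nonneg hθ.le (by linarith)
  obtain ⟨M, hM, hMQ⟩ := exists_mean_bounds_of_meets hE hE0 hK0 (by positivity) habK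
    (fun Q hQ k => volume_log_poreSide_le hK0.le hs.le hσ0 hσ1.le (by linarith) hE0 habK hb ha hQ k)
    hθ.le hβ hθK hβK hβ2
  obtain ⟨M', hM', hMQ'⟩ := exists_mean_bounds hE hθ.le hβ hM hMQ
  exact ⟨θ, hθ.ne', memMuckenhoupt_infDist_rpow hE hE0 hp hθ hM' hMQ'⟩

end HalfOpenCube

end

theorem theorem1 (n : ℕ) (hn : 1 ≤ n) (E : Set (EuclideanSpace ℝ (Fin n))) (hE : E.Nonempty) :
    (∃ C₀ s : ℝ, 0 < C₀ ∧ 0 < s ∧ s < (1 + 2 ^ n)⁻¹ ∧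
      ∀ Q₀ : HalfOpenCube n, (Q₀.toSet ∩ closure E).Nonempty →
        0 < poreRatio s Q₀ E ∧ poreRatio s Q₀ E ≤ ENNReal.ofReal C₀) ↔
    (∀ p : ℝ, 1 < p → ∃ θ : ℝ, θ ≠ 0 ∧
      MemMuckenhoupt p (fun x => Metric.infDist x E ^ θ)) := by
  constructor
  · rintro ⟨C₀, s, hC₀, hs, hsn, h⟩ p hp
    exact HalfOpenCube.exists_memMuckenhoupt_of_poreRatio hE hC₀ hs hsn h hp
  · intro h
    -- The exponent p = 2 alone suffices, and any s below the threshold can be taken.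
    obtain ⟨θ, hθ, hA⟩ := h 2 one_lt_two
    have hE0 := HalfOpenCube.volume_closure_eq_zero_of_isWeight hθ hA.1
    obtain ⟨τ, C, hτ, hC, hτC⟩ := HalfOpenCube.exists_lintegral_mul_le_of_memMuckenhoupt_two hθ hA
    have h0 : (0 : ℝ) < (1 + 2 ^ n)⁻¹ := by positivity
    have h1 : ((1 : ℝ) + 2 ^ n)⁻¹ ≤ 1 := inv_le_one_of_one_le₀ (by
      have : (0 : ℝ) ≤ 2 ^ n := by positivity
      linarith)
    obtain ⟨s, hs, hsn⟩ := exists_between h0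
    obtain ⟨C₀, hC₀, hQ⟩ :=
      HalfOpenCube.exists_poreRatio_le hn hE hE0 hτ hC hs (hsn.trans_le h1) hτC
    exact ⟨C₀, s, hC₀, hs, hsn, hQ⟩
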